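/- Let $V$ be a finite-dimensional Euclidean space, $R\subset V$ a finite, irreducible, (reduced) crystallographic root system spanning $V$, with a fixed basis of simple roots and corresponding positive roots $R^+$. Write $\alpha^\vee=2\alpha/\|\alpha\|^2$, let $A=\{v\in V \mid 0<\langle\alpha,v\rangle<1\ \ \forall \alpha\in R^+\}$ be the Weyl alcove, and let $W^a=W\ltimes Q^\vee$ be the affine Weyl group, generated by the orthogonal reflections $s_\alpha$ ($\alpha\in R$) and the translations by the coroots $\alpha^\vee$. Let $D_0\subset L^2(A)$ be the space of restrictions to $A$ of the $W^a$-invariant smooth functions $V\to\mathbb C$. Then $(-\Delta,D_0)$ is essentially self-adjoint in $L^2(A)$. Let $H_0$ be its closure, i.e. its unique (positive) self-adjoint extension, let $h_0$ be the form of $H_0$, i.e. the closure of the form $(f,g)\mapsto (H_0f,g)_{L^2(A)}$ on $D(H_0)$, and let $Q_0$ be the domain of $h_0$, i.e. the set of $f\in L^2(A)$ for which there is a sequence $u_m\in D(H_0)$ with $u_m\to f$ in $L^2(A)$ and $(H_0(u_m-u_l),u_m-u_l)_{L^2(A)}\to0$ as $m,l\to\infty$. Then $Q_0$ is equal to the Sobolev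 space $$W^{1,2}(A)=\{f\in L^2(A)\mid \partial_\eta f\in L^2(A)\text{ in the sense of distributions on }A,\ \forall\eta\in V\},$$ and for every orthonormal basis $\eta_1,\dots,\eta_n$ of $V$ and all $f,g\in W^{1,2}(A)$ $$h_0(f,g)=(f,g)_{W^{1,2}}-(f,g)_{L^2(A)}=\sum_{j=1}^n\int_A \partial_{\eta_j}f\;\overline{\partial_{\eta_j}g}\,dv ,$$ where $(f,g)_{W^{1,2}}=\int_A f\overline g\,dv+\sum_{j=1}^n\int_A \partial_{\eta_j}f\;\overline{\partial_{\eta_j}g}\,dv$. In other words, the form inner product $h_0(f,g)+(f,g)_{L^2(A)}$ is the $W^{1,2}$ inner product. -/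

import Mathlib

open MeasureTheory Filter Topology
open scoped ContDiff InnerProductSpace

noncomputable section

/-! ### Root systems in a Euclidean space, alcove, affine Weyl group -/

/-- A root pairing of `V` with itself is Euclidean if the pairing is the inner product of `V` and
the coroot of a root `α` is the vector `2 α / ‖α‖²` (so that the reflections of the root pairing
are the orthogonal reflections in the hyperplanes `α^⊥`). -/
structure RootPairing.IsEuclidean {ι V : Type*} [NormedAddCommGroup V] [InnerProductSpace ℝ V]
    (P : RootPairing ι ℝ V V) : Prop where
  pairing_eq : ∀ x y : V, P.toLinearMap x y = inner ℝ x y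
  coroot_eq : ∀ i, P.coroot i = (2 / ‖P.root i‖ ^ 2) • P.root i

/-- The (open) Weyl alcove `{v | 0 < ⟨α, v⟩ < 1 for all positive roots α}`. -/
def RootPairing.Base.alcove {ι V : Type*} [NormedAddCommGroup V] [InnerProductSpace ℝ V]
    {P : RootPairing ι ℝ V V} (b : P.Base) : Set V :=
  {v | ∀ i, b.IsPos i → 0 < inner ℝ (P.root i) v ∧ inner ℝ (P.root i) v < 1}

/-- The affine Weyl group `W ⋉ Q^∨`: the group of affine transformations of `V` generated by the
reflections in the roots and by the translations by the coroots. -/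
def RootPairing.affineWeylGroup {ι V : Type*} [NormedAddCommGroup V] [InnerProductSpace ℝ V]
    (P : RootPairing ι ℝ V V) : Subgroup (V ≃ᵃ[ℝ] V) :=
  Subgroup.closure
    (Set.range (fun i => (P.reflection i).toAffineEquiv) ∪
      Set.range (fun i => AffineEquiv.constVAdd ℝ V (P.coroot i)))

/-! ### The free Laplacian -/

section Analysis

variable {V : Type*} [NormedAddCommGroup V] [InnerProductSpace ℝ V] [FiniteDimensional ℝ V]
  [MeasurableSpace V] [BorelSpace V]

/-- The complex Hilbert space `L²(A)` with respect to the Euclidean (Lebesgue) measure. -/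
abbrev L2On (A : Set V) : Type _ := Lp ℂ 2 ((volume : Measure V).restrict A)

/-- The graph of the operator `-Δ` in `L²(A)` whose domain consists of the restrictions to `A` of
the smooth functions `V → ℂ` that are invariant under the group `G`. -/
def negLaplacianGraph (G : Subgroup (V ≃ᵃ[ℝ] V)) (A : Set V) :
    Submodule ℂ (L2On A × L2On A) where
  carrier := {F | ∃ f : V → ℂ, ContDiff ℝ ∞ f ∧ (∀ w ∈ G, ∀ v, f (w v) = f v) ∧
    F.1 =ᵐ[volume.restrict A] f ∧ F.2 =ᵐ[volume.restrict A] fun v => -Laplacian.laplacian f v}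
  zero_mem' := by
    refine ⟨fun _ => 0, contDiff_const, fun _ _ _ => rfl, Lp.coeFn_zero _ _ _, ?_⟩
    filter_upwards [Lp.coeFn_zero ℂ 2 ((volume : Measure V).restrict A)] with v hv
    exact hv.trans (by simp)
  add_mem' := by
    rintro ⟨F₁, F₂⟩ ⟨K₁, K₂⟩ ⟨f, hf, hfG, hf₁, hf₂⟩ ⟨k, hk, hkG, hk₁, hk₂⟩
    refine ⟨f + k, hf.add hk, fun w hw v => by simp [hfG w hw v, hkG w hw v], ?_, ?_⟩
    · exact (Lp.coeFn_add F₁ K₁).trans (hf₁.add hk₁)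
    · refine (Lp.coeFn_add F₂ K₂).trans ((hf₂.add hk₂).trans (ae_of_all _ fun v => ?_))
      have h2 : (2 : WithTop ℕ∞) ≤ ∞ := WithTop.coe_le_coe.2 (le_top : (2 : ℕ∞) ≤ ⊤)
      simp only [Pi.add_apply]
      rw [ContDiffAt.laplacian_add (hf.of_le h2).contDiffAt (hk.of_le h2).contDiffAt]
      ring
  smul_mem' := by
    rintro c ⟨F₁, F₂⟩ ⟨f, hf, hfG, hf₁, hf₂⟩
    refine ⟨c • f, hf.const_smul c, fun w hw v => by simp [hfG w hw v], ?_, ?_⟩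
    · exact (Lp.coeFn_smul c F₁).trans (hf₁.const_smul c)
    · refine (Lp.coeFn_smul c F₂).trans ((hf₂.const_smul c).trans (ae_of_all _ fun v => ?_))
      have h2 : (2 : WithTop ℕ∞) ≤ ∞ := WithTop.coe_le_coe.2 (le_top : (2 : ℕ∞) ≤ ⊤)
      simp only [Pi.smul_apply]
      rw [InnerProductSpace.laplacian_smul c (hf.of_le h2).contDiffAt]
      simp

/-- The operator `-Δ` in `L²(A)` with domain the restrictions to `A` of the smooth `G`-invariant
functions on `V`. -/
def negLaplacian (G : Subgroup (V ≃ᵃ[ℝ] V)) (A : Set V) : L2On A →ₗ.[ℂ] L2On A :=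
  (negLaplacianGraph G A).toLinearPMap

/-- For open `A` the graph defining `negLaplacian` is indeed the graph of an operator. -/
theorem negLaplacian_graph (G : Subgroup (V ≃ᵃ[ℝ] V)) {A : Set V} (hA : IsOpen A) :
    (negLaplacian G A).graph = negLaplacianGraph G A := by
  refine Submodule.toLinearPMap_graph_eq _ ?_
  rintro ⟨F₁, F₂⟩ ⟨f, hf, -, hf₁, hf₂⟩ h0
  simp only at h0 hf₁ hf₂ ⊢
  subst h0
  have hz : f =ᵐ[volume.restrict A] fun _ => (0 : ℂ) :=
    hf₁.symm.trans (Lp.coeFn_zero _ _ _)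
  have hon : Set.EqOn f (fun _ => (0 : ℂ)) A :=
    Measure.eqOn_open_of_ae_eq hz hA hf.continuous.continuousOn continuousOn_const
  refine Lp.ext (hf₂.trans (EventuallyEq.trans ?_ (Lp.coeFn_zero _ _ _).symm))
  filter_upwards [ae_restrict_mem hA.measurableSet] with v hv
  have : f =ᶠ[𝓝 v] fun _ => (0 : ℂ) := by
    filter_upwards [hA.mem_nhds hv] with x hx using hon hx
  have := (InnerProductSpace.laplacian_congr_nhds this).self_of_nhds
  simp [this]

/-- The free Laplacian `H₀` on the alcove of a base `b` of a root system: the closure of `-Δ` on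
the restrictions of the smooth functions on `V` invariant under the affine Weyl group. -/
def freeLaplacian {ι : Type*} {P : RootPairing ι ℝ V V} (b : P.Base) :
    L2On b.alcove →ₗ.[ℂ] L2On b.alcove :=
  (negLaplacian P.affineWeylGroup b.alcove).closure

/-! ### The form of a positive operator -/

/-- The sequence `u` in the domain of `T` converges to `f` in the Hilbert space and is Cauchy with
respect to the quadratic form `u ↦ ⟨T u, u⟩` of `T`. -/
def FormTendsto {H : Type*} [NormedAddCommGroup H] [InnerProductSpace ℂ H] (T : H →ₗ.[ℂ] H)
    (u : ℕ → T.domain) (f : H) : Prop :=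
  Tendsto (fun n => (u n : H)) atTop (𝓝 f) ∧
    Tendsto (fun p : ℕ × ℕ => inner ℂ ((u p.1 - u p.2 : T.domain) : H) (T (u p.1 - u p.2)))
      atTop (𝓝 0)

/-- The form domain `Q(T)` of a positive (self-adjoint) operator `T`: the domain of the closure of
the form `(f, g) ↦ ⟨T f, g⟩`, that is, the form completion of `D(T)`. -/
def formDomain {H : Type*} [NormedAddCommGroup H] [InnerProductSpace ℂ H] (T : H →ₗ.[ℂ] H) :
    Set H :=
  {f | ∃ u : ℕ → T.domain, FormTendsto T u f}

/-- The form `q_T`, the closure of `(f, g) ↦ ⟨T f, g⟩`, is defined at `(f, g)` and has the value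
`z` there. It is linear in `f` and antilinear in `g` (Mathlib's `inner` is antilinear in the first
argument). -/
def HasFormValue {H : Type*} [NormedAddCommGroup H] [InnerProductSpace ℂ H] (T : H →ₗ.[ℂ] H)
    (f g : H) (z : ℂ) : Prop :=
  f ∈ formDomain T ∧ g ∈ formDomain T ∧
    ∀ u v : ℕ → T.domain, FormTendsto T u f → FormTendsto T v g →
      Tendsto (fun n => inner ℂ (v n : H) (T (u n))) atTop (𝓝 z)

/-! ### The Sobolev space -/

/-- `∂_η f = g` in the sense of distributions on `A`. -/
def HasWeakDeriv (A : Set V) (η : V) (f g : L2On A) : Prop :=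
  ∀ φ : V → ℝ, ContDiff ℝ ∞ φ → HasCompactSupport φ → tsupport φ ⊆ A →
    ∫ v in A, (fderiv ℝ φ v η) • f v = -∫ v in A, φ v • g v

/-- The Sobolev space `W^{1,2}(A)`. -/
def sobolevW12 (A : Set V) : Set (L2On A) :=
  {f | ∀ η : V, ∃ g : L2On A, HasWeakDeriv A η f g}

open Classical in
/-- The weak derivative `∂_η f ∈ L²(A)` (zero if it does not exist). -/
def weakDeriv (A : Set V) (η : V) (f : L2On A) : L2On A :=
  if h : ∃ g : L2On A, HasWeakDeriv A η f g then h.choose else 0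

/-- The gradient part `∑ⱼ ∫_A (∂_{ηⱼ} f) conj (∂_{ηⱼ} g)` of the Sobolev inner product. -/
def gradientForm {κ : Type*} [Fintype κ] (A : Set V) (η : OrthonormalBasis κ ℝ V)
    (f g : L2On A) : ℂ :=
  ∑ j, ∫ v in A, weakDeriv A (η j) f v * (starRingEnd ℂ) (weakDeriv A (η j) g v)

/-- The inner product `∫_A f conj g + ∑ⱼ ∫_A (∂_{ηⱼ} f) conj (∂_{ηⱼ} g)` of `W^{1,2}(A)`. -/
def sobolevInner {κ : Type*} [Fintype κ] (A : Set V) (η : OrthonormalBasis κ ℝ V)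
    (f g : L2On A) : ℂ :=
  (∫ v in A, f v * (starRingEnd ℂ) (g v)) + gradientForm A η f g

end Analysis

end

/-! The operator `-Δ` on invariant functions is the Neumann Laplacian of the alcove, and its form is
the Dirichlet form. A smooth `W^a`-invariant function `g` is even under the affine reflection in
each wall, so its normal derivative vanishes there and Green's formula has no boundary term: `⟪-Δ g,
f⟫ = ∑ ⟪∂_j g, ∂_j f⟫` for every `f` in `W^{1,2}(A)`. No traces are needed. A cutoff near a wall has
gradient of size `O(1/d)` in the distance `d` to the wall, the normal derivative of `g` is `O(d)`,
and dominated convergence removes the cutoff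
(`sum_integral_fderiv_mul_eq_neg_integral_laplacian_mul`). The identity passes to the closure `H₀`
(`GreenIdentity.exists_of_tendsto`).

Hence a sequence that converges in `L²` and is Cauchy for the form converges in `W^{1,2}`, which
gives `Q₀ ⊆ W^{1,2}(A)` and the formula for the form. Equality means that `D(H₀)` is dense in
`W^{1,2}(A)`: by Green's formula a Sobolev function orthogonal to `D(H₀)` in the `W^{1,2}` inner
product is orthogonal in `L²` to the range of `1 + H₀`, so it vanishes once the range of `1 - Δ` on
`D₀` is dense. The same density, with positivity, gives essential self-adjointness.

The density comes from explicit eigenfunctions, the sums of plane waves over Weyl group orbits with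
frequency in the dual lattice of `Q^∨`. They are complete on the alcove because the plane waves are
the Fourier monomials of the torus `V / Q^∨`, and because no nontrivial element of `W^a` carries a
point of the alcove into the alcove. That last fact is root combinatorics:
`eq_zero_of_mem_closure_coroot` kills the translation part and the deletion property kills the
linear part. -/

noncomputable section

namespace RootPairing

/-! ### Words in simple reflections and positivity of roots -/

section Combinatorics

variable {ι R M N : Type*} [CommRing R] [CharZero R] [IsDomain R] [AddCommGroup M] [Module R M]
  [AddCommGroup N] [Module R N] [Finite ι] {P : RootPairing ι R M N} [P.IsCrystallographic]

/-- The linear automorphism given by a word in the reflections. -/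
def wordMap (P : RootPairing ι R M N) (L : List ι) : M ≃ₗ[R] M := (L.map P.reflection).prod

omit [CharZero R] [IsDomain R] [Finite ι] [P.IsCrystallographic] in
theorem reflection_mul_reflection_self (i : ι) : P.reflection i * P.reflection i = 1 := by
  ext x
  simp

/-- The permutation of the roots given by a word in the reflections. -/
def wordPerm (P : RootPairing ι R M N) (L : List ι) : Equiv.Perm ι :=
  (L.map P.reflectionPerm).prod

omit [CharZero R] [IsDomain R] [Finite ι] [P.IsCrystallographic] in
theorem root_wordPerm (L : List ι) (i : ι) :
    P.root (P.wordPerm L i) = P.wordMap L (P.root i) := by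
  induction L with
  | nil => simp [wordPerm, wordMap]
  | cons j L ih =>
    have h1 : P.wordPerm (j :: L) i = P.reflectionPerm j (P.wordPerm L i) := by simp [wordPerm]
    have h2 : P.wordMap (j :: L) (P.root i) = P.reflection j (P.wordMap L (P.root i)) := by
      simp [wordMap]
    rw [h1, h2, root_reflectionPerm, ih]

omit [CharZero R] [IsDomain R] [P.IsCrystallographic] [Finite ι] in
/-- Conjugating a reflection by a word gives the reflection in the transformed root. -/
theorem reflection_wordPerm (L : List ι) (i : ι) :
    P.reflection (P.wordPerm L i) * P.wordMap L = P.wordMap L * P.reflection i := by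
  induction L with
  | nil => simp [wordPerm, wordMap]
  | cons j L ih =>
    have h1 : P.wordPerm (j :: L) i = P.reflectionPerm j (P.wordPerm L i) := by simp [wordPerm]
    have h2 : P.wordMap (j :: L) = P.reflection j * P.wordMap L := by simp [wordMap]
    rw [h1, h2, reflection_reflectionPerm, mul_assoc, ← mul_assoc (P.reflection j) (P.reflection j),
      reflection_mul_reflection_self, one_mul, mul_assoc, ih, mul_assoc]

omit [CharZero R] [IsDomain R] [P.IsCrystallographic] [Finite ι] in
theorem wordPerm_append_singleton (L : List ι) (i k : ι) :
    P.wordPerm (L ++ [i]) k = P.wordPerm L (P.reflectionPerm i k) := by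
  simp [wordPerm]

variable [P.IsReduced] (b : P.Base)

/-- The deletion property. -/
theorem Base.exists_wordMap_eq_of_not_isPos (L : List ι) (hL : ∀ j ∈ L, j ∈ b.support) {i : ι}
    (hi : i ∈ b.support) (hneg : ¬ b.IsPos (P.wordPerm L i)) :
    ∃ L' : List ι, (∀ j ∈ L', j ∈ b.support) ∧ L'.length + 1 = L.length ∧
      P.wordMap L = P.wordMap L' * P.reflection i := by
  induction L with
  | nil => exact absurd (b.isPos_of_mem_support hi) (by simpa [wordPerm] using hneg)
  | cons j L ih =>
    have h1 : P.wordPerm (j :: L) i = P.reflectionPerm j (P.wordPerm L i) := by simp [wordPerm]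
    have h2 (L : List ι) : P.wordMap (j :: L) = P.reflection j * P.wordMap L := by simp [wordMap]
    have hLs : ∀ k ∈ L, k ∈ b.support := fun k hk => hL k (List.mem_cons_of_mem _ hk)
    by_cases hp : b.IsPos (P.wordPerm L i)
    -- The simple reflection in `j` permutes the positive roots other than `j`, so the sign can
    -- change only at `j` itself. Conjugation then moves this letter to the right end of the word as
    -- the reflection in `i`.
    · have hj : P.wordPerm L i = j := by
        by_contra hne
        exact hneg (h1 ▸ hp.reflectionPerm (hL j List.mem_cons_self) hne)
      refine ⟨L, hLs, rfl, ?_⟩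
      rw [h2, ← reflection_wordPerm, hj]
    · obtain ⟨L', hL', hlen, hw⟩ := ih hLs hp
      refine ⟨j :: L', ?_, by simp [hlen], ?_⟩
      · intro k hk
        rcases List.mem_cons.1 hk with rfl | hk
        · exact hL _ List.mem_cons_self
        · exact hL' k hk
      · rw [h2, h2, hw, mul_assoc]

/-- Descent on the length of the word: if it ends in `i` and sends `i` to a positive root, then the
word without its last letter sends `i` to a negative root. Deletion rewrites that shorter word as
one ending in the reflection in `i`, the two reflections cancel, and the same element is given by
two letters fewer. -/
theorem Base.wordMap_eq_one_of_forall_isPos (L : List ι) (hL : ∀ j ∈ L, j ∈ b.support)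
    (hpos : ∀ i ∈ b.support, b.IsPos (P.wordPerm L i)) : P.wordMap L = 1 := by
  induction hn : L.length using Nat.strong_induction_on generalizing L with
  | _ n ih =>
    rcases List.eq_nil_or_concat L with rfl | ⟨L₁, i, rfl⟩
    · simp [wordMap]
    · rw [List.concat_eq_append] at *
      have hi : i ∈ b.support := hL i (by simp)
      have hL₁ : ∀ j ∈ L₁, j ∈ b.support := fun j hj => hL j (by simp [hj])
      have hneg : ¬ b.IsPos (P.wordPerm L₁ i) := by
        have h := hpos i hi
        rw [wordPerm_append_singleton] at h
        have hr : P.root (P.wordPerm L₁ i) = -P.root (P.wordPerm L₁ (P.reflectionPerm i i)) := by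
          rw [root_wordPerm, root_wordPerm, root_reflectionPerm, reflection_apply_self, map_neg,
            neg_neg]
        rw [root_eq_neg_iff] at hr
        rw [hr]
        have := (Base.IsPos.neg_iff_not b (P.wordPerm L₁ (P.reflectionPerm i i)))
        intro h'
        exact this.1 h' h
      obtain ⟨L', hL', hlen, hw⟩ := b.exists_wordMap_eq_of_not_isPos L₁ hL₁ hi hneg
      have hw' : P.wordMap (L₁ ++ [i]) = P.wordMap L' := by
        have : P.wordMap (L₁ ++ [i]) = P.wordMap L₁ * P.reflection i := by simp [wordMap]
        rw [this, hw, mul_assoc, reflection_mul_reflection_self, mul_one]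
      rw [hw']
      refine ih L'.length (by simp at hn; omega) L' hL' (fun k hk => ?_) rfl
      have : P.wordPerm L' k = P.wordPerm (L₁ ++ [i]) k := by
        apply P.root.injective
        rw [root_wordPerm, root_wordPerm, hw']
      rw [this]
      exact hpos k hk

/-- Every product of reflections is a product of simple reflections. -/
theorem Base.exists_wordMap_eq (w : M ≃ₗ[R] M)
    (hw : w ∈ Subgroup.closure (Set.range P.reflection)) :
    ∃ L : List ι, (∀ j ∈ L, j ∈ b.support) ∧ P.wordMap L = w := by
  have hap (L₁ L₂ : List ι) : P.wordMap (L₁ ++ L₂) = P.wordMap L₁ * P.wordMap L₂ := by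
    simp [wordMap]
  have key : ∀ i, ∃ L : List ι, (∀ j ∈ L, j ∈ b.support) ∧ P.wordMap L = P.reflection i := by
    intro i
    refine b.induction_reflect (p := fun i => ∃ L : List ι, (∀ j ∈ L, j ∈ b.support) ∧
      P.wordMap L = P.reflection i) i (fun i hi => ?_) (fun i hi => ⟨[i], by simpa, by simp [wordMap]⟩)
      (fun i j hi hj => ?_)
    -- The index `P.reflectionPerm i i` belongs to the negative of root `i`, which has the same
    -- reflection.
    · rw [reflection_reflectionPerm, reflection_mul_reflection_self, one_mul]
      exact hi
    · obtain ⟨L, hL, hLw⟩ := hi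
      refine ⟨[j] ++ (L ++ [j]), ?_, ?_⟩
      · intro k hk
        simp only [List.mem_append, List.mem_singleton] at hk
        rcases hk with rfl | hk | rfl
        exacts [hj, hL k hk, hj]
      · rw [hap, hap, hLw, reflection_reflectionPerm, mul_assoc]
        simp [wordMap]
  induction hw using Subgroup.closure_induction'' with
  | mem x hx => obtain ⟨i, rfl⟩ := hx; exact key i
  | inv_mem x hx => obtain ⟨i, rfl⟩ := hx; rw [reflection_inv]; exact key i
  | one => exact ⟨[], by simp, by simp [wordMap]⟩
  | mul x y _ _ hx hy =>
    obtain ⟨L₁, h₁, rfl⟩ := hx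
    obtain ⟨L₂, h₂, rfl⟩ := hy
    refine ⟨L₁ ++ L₂, fun j hj => ?_, hap _ _⟩
    rcases List.mem_append.1 hj with hj | hj
    exacts [h₁ j hj, h₂ j hj]

/-- An element of the Weyl group that maps simple roots to positive roots is trivial. -/
theorem Base.eq_one_of_forall_isPos (w : M ≃ₗ[R] M)
    (hw : w ∈ Subgroup.closure (Set.range P.reflection))
    (hpos : ∀ i ∈ b.support, ∀ k, P.root k = w (P.root i) → b.IsPos k) : w = 1 := by
  obtain ⟨L, hL, rfl⟩ := b.exists_wordMap_eq w hw
  exact b.wordMap_eq_one_of_forall_isPos L hL fun i hi => hpos i hi _ (root_wordPerm L i)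

end Combinatorics

/-! ### Short vectors of the coroot lattice -/

section CorootLattice

variable {ι M N : Type*} [AddCommGroup M] [Module ℝ M]
  [AddCommGroup N] [Module ℝ N] [Finite ι] {P : RootPairing ι ℝ M N} [P.IsCrystallographic]

/-- Induction on the number of coroots in the sum. If the root of the first coroot `j` pairs
nonnegatively with all the others, its pairing with the sum is at least `2`, a contradiction.
Otherwise some coroot `k` makes an obtuse angle with `j`; the two add up to zero or to a coroot, and
the sum becomes shorter. -/
theorem coroot_list_sum_eq_zero_of_forall_le_one (L : List ι)
    (h : ∀ i, P.toLinearMap (P.root i) (L.map P.coroot).sum ≤ 1) :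
    (L.map P.coroot).sum = 0 := by
  induction hn : L.length using Nat.strong_induction_on generalizing L with
  | _ n ih =>
    rcases L with _ | ⟨j, L⟩
    · simp
    · by_cases hall : ∀ k ∈ L, 0 ≤ P.pairing j k
      · exfalso
        have h1 := h j
        have h2 : 0 ≤ P.toLinearMap (P.root j) (L.map P.coroot).sum := by
          rw [map_list_sum, List.map_map]
          refine List.sum_nonneg ?_
          simp only [List.mem_map, Function.comp_apply]
          rintro x ⟨k, hk, rfl⟩
          exact hall k hk
        simp only [List.map_cons, List.sum_cons, map_add, P.root_coroot_two] at h1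
        linarith
      · push Not at hall
        obtain ⟨k, hk, hneg⟩ := hall
        obtain ⟨L', hperm⟩ : ∃ L', L.Perm (k :: L') := by
          classical exact ⟨_, List.perm_cons_erase hk⟩
        have hsum : ((j :: L).map P.coroot).sum
            = P.coroot j + P.coroot k + (L'.map P.coroot).sum := by
          have := (hperm.map P.coroot).sum_eq
          simp only [List.map_cons, List.sum_cons] at this ⊢
          rw [this, add_assoc]
        have hlen : L'.length + 2 = n := by
          have := hperm.length_eq
          simp only [List.length_cons] at this hn
          omega
        by_cases hz : P.coroot j = -P.coroot k
        · have hsum' : ((j :: L).map P.coroot).sum = (L'.map P.coroot).sum := by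
            rw [hsum, hz]; simp
          rw [hsum'] at h ⊢
          exact ih _ (by omega) L' h rfl
        · have hmem := P.flip.root_add_root_mem_of_pairingIn_neg (i := j) (j := k) ?_ hz
          · obtain ⟨m, hm⟩ := hmem
            have hsum' : ((j :: L).map P.coroot).sum = ((m :: L').map P.coroot).sum := by
              rw [hsum, List.map_cons, List.sum_cons]
              congr 1
              exact hm.symm
            rw [hsum'] at h ⊢
            exact ih _ (by simp; omega) (m :: L') h rfl
          -- Passing to the dual system interchanges the two indices; the sign of a pairing is
          -- symmetric in them.
          · have h1 : P.pairingIn ℤ j k < 0 := by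
              have := P.algebraMap_pairingIn ℤ j k
              rw [← this] at hneg
              simpa using hneg
            have h2 : P.pairingIn ℤ k j < 0 := by
              rwa [P.pairingIn_lt_zero_iff]
            exact h2

/-- A vector of the coroot lattice that pairs with all roots to values at most one vanishes. -/
theorem eq_zero_of_mem_closure_coroot (μ : N) (hμ : μ ∈ AddSubgroup.closure (Set.range P.coroot))
    (h : ∀ i, P.toLinearMap (P.root i) μ ≤ 1) : μ = 0 := by
  obtain ⟨L, rfl⟩ : ∃ L : List ι, (L.map P.coroot).sum = μ := by
    clear h
    induction hμ using AddSubgroup.closure_induction'' with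
    | mem x hx => obtain ⟨i, rfl⟩ := hx; exact ⟨[i], by simp⟩
    | neg_mem x hx =>
      obtain ⟨i, rfl⟩ := hx
      obtain ⟨j, hj⟩ := P.neg_coroot_mem i
      exact ⟨[j], by simp [hj]⟩
    | zero => exact ⟨[], rfl⟩
    | add x y _ _ hx hy =>
      obtain ⟨L₁, rfl⟩ := hx
      obtain ⟨L₂, rfl⟩ := hy
      exact ⟨L₁ ++ L₂, by simp⟩
  exact coroot_list_sum_eq_zero_of_forall_le_one L h

end CorootLattice

end RootPairing

namespace RootPairing

/-! ### The affine Weyl group and the geometry of the alcove -/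

section Euclidean

variable {ι V : Type*} [NormedAddCommGroup V] [InnerProductSpace ℝ V] {P : RootPairing ι ℝ V V}

/-- The Weyl group as a group of linear automorphisms. -/
def linearWeylGroup (P : RootPairing ι ℝ V V) : Subgroup (V ≃ₗ[ℝ] V) :=
  Subgroup.closure (Set.range P.reflection)

/-- The lattice spanned by the coroots. -/
def corootLattice (P : RootPairing ι ℝ V V) : AddSubgroup V :=
  AddSubgroup.closure (Set.range P.coroot)

theorem exists_root_eq_of_mem_linearWeylGroup {u : V ≃ₗ[ℝ] V} (hu : u ∈ P.linearWeylGroup)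
    (i : ι) : ∃ k, P.root k = u (P.root i) := by
  induction hu using Subgroup.closure_induction'' generalizing i with
  | mem x hx => obtain ⟨j, rfl⟩ := hx; exact ⟨_, P.root_reflectionPerm j i⟩
  | inv_mem x hx =>
    obtain ⟨j, rfl⟩ := hx
    rw [reflection_inv]
    exact ⟨_, P.root_reflectionPerm j i⟩
  | one => exact ⟨i, rfl⟩
  | mul x y _ _ hx hy =>
    obtain ⟨k, hk⟩ := hy i
    obtain ⟨l, hl⟩ := hx k
    exact ⟨l, by rw [hl, hk]; rfl⟩

/-- The roots span, so an element is determined by its permutation of the finitely many roots. -/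
theorem finite_linearWeylGroup [Finite ι] [P.IsRootSystem] : Finite P.linearWeylGroup := by
  choose p hp using fun (u : P.linearWeylGroup) (i : ι) =>
    exists_root_eq_of_mem_linearWeylGroup u.2 i
  refine Finite.of_injective p fun u u' h => ?_
  have : (u.1 : V →ₗ[ℝ] V) = u'.1 := by
    refine LinearMap.ext_on (s := Set.range P.root) IsRootSystem.span_root_eq_top ?_
    rintro _ ⟨i, rfl⟩
    have h1 := hp u i
    have h2 := hp u' i
    rw [h, h2] at h1
    exact h1.symm
  exact Subtype.ext (LinearEquiv.toLinearMap_injective this)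

namespace IsEuclidean

variable (hP : P.IsEuclidean)
include hP

theorem pairing_eq_inner (i j : ι) : P.pairing i j = ⟪P.root i, P.coroot j⟫_ℝ :=
  hP.pairing_eq _ _

theorem reflection_apply_eq (i : ι) (x : V) :
    P.reflection i x = x - ⟪P.root i, x⟫_ℝ • P.coroot i := by
  rw [P.reflection_apply]
  have : P.coroot' i x = ⟪x, P.coroot i⟫_ℝ := hP.pairing_eq _ _
  rw [this, hP.coroot_eq, inner_smul_right, smul_smul, real_inner_comm, mul_comm]

theorem inner_reflection (i : ι) (x y : V) :
    ⟪P.reflection i x, P.reflection i y⟫_ℝ = ⟪x, y⟫_ℝ := by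
  have h0 : ‖P.root i‖ ≠ 0 := norm_ne_zero_iff.2 (P.ne_zero i)
  rw [hP.reflection_apply_eq, hP.reflection_apply_eq, hP.coroot_eq]
  simp only [inner_sub_left, inner_sub_right, inner_smul_left, inner_smul_right,
    real_inner_self_eq_norm_sq, RCLike.conj_to_real, real_inner_comm (P.root i)]
  field_simp
  ring

theorem inner_apply_apply {u : V ≃ₗ[ℝ] V} (hu : u ∈ P.linearWeylGroup) (x y : V) :
    ⟪u x, u y⟫_ℝ = ⟪x, y⟫_ℝ := by
  induction hu using Subgroup.closure_induction'' generalizing x y with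
  | mem w hw => obtain ⟨j, rfl⟩ := hw; exact hP.inner_reflection j x y
  | inv_mem w hw => obtain ⟨j, rfl⟩ := hw; rw [reflection_inv]; exact hP.inner_reflection j x y
  | one => rfl
  | mul w w' _ _ hx hy => exact (hx _ _).trans (hy _ _)

theorem apply_mem_corootLattice {u : V ≃ₗ[ℝ] V} (hu : u ∈ P.linearWeylGroup) {μ : V}
    (hμ : μ ∈ P.corootLattice) : u μ ∈ P.corootLattice := by
  have h : P.corootLattice ≤ P.corootLattice.comap (u : V →+ V) := by
    rw [corootLattice, AddSubgroup.closure_le]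
    rintro _ ⟨i, rfl⟩
    obtain ⟨k, hk⟩ := exists_root_eq_of_mem_linearWeylGroup hu i
    have hn : ‖P.root k‖ ^ 2 = ‖P.root i‖ ^ 2 := by
      rw [hk, ← real_inner_self_eq_norm_sq, hP.inner_apply_apply hu, real_inner_self_eq_norm_sq]
    have : P.coroot k = u (P.coroot i) := by
      rw [hP.coroot_eq, hP.coroot_eq, map_smul, hn, hk]
    exact AddSubgroup.subset_closure ⟨k, this⟩
  exact h hμ

/-- Elements of the affine Weyl group are compositions of an element of the Weyl group and a
translation by a vector of the coroot lattice. -/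
theorem exists_apply_eq_of_mem_affineWeylGroup {w : V ≃ᵃ[ℝ] V} (hw : w ∈ P.affineWeylGroup) :
    ∃ u ∈ P.linearWeylGroup, ∃ μ ∈ P.corootLattice, ∀ x, w x = u x + μ := by
  have hinv : ∀ i, (AffineEquiv.constVAdd ℝ V (P.coroot i))⁻¹
      = AffineEquiv.constVAdd ℝ V (-P.coroot i) := fun i => by
    rw [← AffineEquiv.constVAdd_symm]; rfl
  have hinv' : ∀ i, (P.reflection i).toAffineEquiv⁻¹ = (P.reflection i).toAffineEquiv := fun i => by
    apply inv_eq_of_mul_eq_one_right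
    ext x
    simp [AffineEquiv.mul_def]
  have hr : ∀ i, P.reflection i ∈ P.linearWeylGroup := fun i => Subgroup.subset_closure ⟨i, rfl⟩
  have hc : ∀ i, P.coroot i ∈ P.corootLattice := fun i => AddSubgroup.subset_closure ⟨i, rfl⟩
  induction hw using Subgroup.closure_induction'' with
  | mem w hw =>
    rcases hw with ⟨i, rfl⟩ | ⟨i, rfl⟩
    · exact ⟨_, hr i, 0, zero_mem _, fun x => by simp⟩
    · exact ⟨1, one_mem _, _, hc i, fun x => by simp [add_comm]⟩
  | inv_mem w hw =>
    rcases hw with ⟨i, rfl⟩ | ⟨i, rfl⟩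
    · exact ⟨_, hr i, 0, zero_mem _, fun x => by simp [hinv']⟩
    · exact ⟨1, one_mem _, _, neg_mem (hc i), fun x => by simp [hinv, add_comm]⟩
  | one => exact ⟨1, one_mem _, 0, zero_mem _, fun x => by simp⟩
  | mul w w' _ _ hx hy =>
    obtain ⟨u, hu, μ, hμ, h⟩ := hx
    obtain ⟨u', hu', μ', hμ', h'⟩ := hy
    refine ⟨u * u', mul_mem hu hu', u μ' + μ,
      add_mem (hP.apply_mem_corootLattice hu hμ') hμ, fun x => ?_⟩
    rw [AffineEquiv.coe_mul, Function.comp_apply, h', h, map_add]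
    exact add_assoc _ _ _

theorem exists_inner_eq_int [P.IsCrystallographic] (i : ι) {μ : V} (hμ : μ ∈ P.corootLattice) :
    ∃ z : ℤ, ⟪P.root i, μ⟫_ℝ = z := by
  have h : P.corootLattice ≤ (Int.castAddHom ℝ).range.comap
      ((innerSL ℝ (P.root i) : V →L[ℝ] ℝ) : V →+ ℝ) := by
    rw [corootLattice, AddSubgroup.closure_le]
    rintro _ ⟨j, rfl⟩
    refine ⟨P.pairingIn ℤ i j, ?_⟩
    have := P.algebraMap_pairingIn ℤ i j
    simpa [hP.pairing_eq_inner] using this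
  obtain ⟨z, hz⟩ := h hμ
  exact ⟨z, by simpa using hz.symm⟩

end IsEuclidean

theorem Base.inner_mem_Ioo_of_mem_alcove (b : P.Base) {x : V} (hx : x ∈ b.alcove) {i : ι}
    (hi : b.IsPos i) : ⟪P.root i, x⟫_ℝ ∈ Set.Ioo (0 : ℝ) 1 := hx i hi

theorem Base.inner_mem_Ioo_of_mem_alcove_of_not_isPos (b : P.Base) {x : V} (hx : x ∈ b.alcove)
    {i : ι} (hi : ¬ b.IsPos i) : ⟪P.root i, x⟫_ℝ ∈ Set.Ioo (-1 : ℝ) 0 := by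
  have h := hx _ ((Base.IsPos.neg_iff_not b i).2 hi)
  have h2 : P.root (P.reflectionPerm i i) = -P.root i := by
    rw [root_reflectionPerm, reflection_apply_self]
  change 0 < inner ℝ (P.root (P.reflectionPerm i i)) x ∧
    inner ℝ (P.root (P.reflectionPerm i i)) x < 1 at h
  rw [h2, inner_neg_left] at h
  exact ⟨by linarith, by linarith⟩

/-- The affine Weyl group acts freely on the translates of the alcove. -/
theorem IsEuclidean.eq_one_of_mem_alcove (hP : P.IsEuclidean) [Finite ι] [P.IsCrystallographic]
    [P.IsReduced] (b : P.Base) {u : V ≃ₗ[ℝ] V} (hu : u ∈ P.linearWeylGroup) {μ : V}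
    (hμ : μ ∈ P.corootLattice) {x : V} (hx : x ∈ b.alcove) (hux : u x + μ ∈ b.alcove) :
    u = 1 ∧ μ = 0 := by
  have hinv : u⁻¹ ∈ P.linearWeylGroup := inv_mem hu
  have hin (i : ι) : ⟪P.root i, u x + μ⟫_ℝ = ⟪u⁻¹ (P.root i), x⟫_ℝ + ⟪P.root i, μ⟫_ℝ := by
    rw [inner_add_right, ← hP.inner_apply_apply hu (u⁻¹ (P.root i)) x]
    congr 2
    exact (u.apply_symm_apply (P.root i)).symm
  have hbd (i : ι) : ⟪P.root i, x⟫_ℝ ∈ Set.Ioo (-1 : ℝ) 1 := by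
    by_cases hi : b.IsPos i
    · have := b.inner_mem_Ioo_of_mem_alcove hx hi
      exact ⟨by linarith [this.1], this.2⟩
    · have := b.inner_mem_Ioo_of_mem_alcove_of_not_isPos hx hi
      exact ⟨this.1, by linarith [this.2]⟩
  have hle (i : ι) : ⟪P.root i, μ⟫_ℝ ≤ 1 := by
    -- Root pairings with points of the alcove lie in `(-1, 1)`, so the pairing of a root with `μ`,
    -- a difference of two such numbers, is less than `2`. Being an integer it is at most `1`.
    obtain ⟨z, hz⟩ := hP.exists_inner_eq_int i hμ
    obtain ⟨k, hk⟩ := exists_root_eq_of_mem_linearWeylGroup hinv i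
    have h1 := hin i
    rw [← hk, hz] at h1
    have h2 := hbd k
    have h3 : ⟪P.root i, u x + μ⟫_ℝ < 1 := by
      by_cases hi : b.IsPos i
      · exact (b.inner_mem_Ioo_of_mem_alcove hux hi).2
      · linarith [(b.inner_mem_Ioo_of_mem_alcove_of_not_isPos hux hi).2]
    rw [hz]
    have : (z : ℝ) < 2 := by linarith [h2.1]
    have : z < 2 := by exact_mod_cast this
    exact_mod_cast (by omega : z ≤ 1)
  have hμ0 : μ = 0 := eq_zero_of_mem_closure_coroot (P := P) μ hμ fun i => by
    rw [hP.pairing_eq]; exact hle i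
  refine ⟨?_, hμ0⟩
  -- The sign of the pairing with `x` detects positivity of a root. For a simple root `α`, the
  -- pairing of `u⁻¹ α` with `x` is that of `α` with `u x`, which is positive.
  rw [← inv_eq_one]
  refine b.eq_one_of_forall_isPos _ hinv fun i hi k hk => ?_
  by_contra hneg
  have h1 := hin i
  rw [← hk, hμ0, inner_zero_right, add_zero, add_zero] at h1
  rw [hμ0, add_zero] at hux
  linarith [(b.inner_mem_Ioo_of_mem_alcove hux (b.isPos_of_mem_support hi)).1,
    (b.inner_mem_Ioo_of_mem_alcove_of_not_isPos hx hneg).2]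

open Classical in
/-- The constants in the description of the alcove by one inequality for each root. -/
def Base.alcoveOffset (b : P.Base) (i : ι) : ℝ := if b.IsPos i then 0 else 1

/-- A negative root with offset `1` encodes the upper bound `1` on the opposite positive root. One
inequality per root is the polytope form in which the cutoffs and Green's formula are stated. -/
theorem Base.alcove_eq (b : P.Base) :
    b.alcove = {v | ∀ i, 0 < ⟪P.root i, v⟫_ℝ + b.alcoveOffset i} := by
  ext v
  constructor
  · intro hv i
    by_cases hi : b.IsPos i
    · simpa [alcoveOffset, hi] using (b.inner_mem_Ioo_of_mem_alcove hv hi).1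
    · have := (b.inner_mem_Ioo_of_mem_alcove_of_not_isPos hv hi).1
      simp only [alcoveOffset, hi, if_false]
      linarith
  · intro hv i hi
    have h1 := hv i
    have h2 := hv (P.reflectionPerm i i)
    have h3 : ¬ b.IsPos (P.reflectionPerm i i) :=
      fun h => (Base.IsPos.neg_iff_not b i).1 h hi
    rw [root_reflectionPerm, reflection_apply_self, inner_neg_left] at h2
    simp only [alcoveOffset, hi, h3, if_true, if_false, add_zero] at h1 h2
    exact ⟨h1, by linarith⟩

theorem Base.isOpen_alcove [Finite ι] (b : P.Base) : IsOpen b.alcove := by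
  rw [b.alcove_eq, Set.ofPred_forall]
  refine isOpen_iInter_of_finite fun i => isOpen_lt continuous_const (by fun_prop)

/-- The simple roots span `V`, so pairing with them embeds `V` linearly in a coordinate space, and
on the alcove all these coordinates lie in `(0, 1)`. -/
theorem Base.isBounded_alcove [FiniteDimensional ℝ V] [P.IsRootSystem] (b : P.Base) :
    Bornology.IsBounded b.alcove := by
  let L : V →ₗ[ℝ] (b.support → ℝ) := LinearMap.pi fun i => (innerSL ℝ (P.root i)).toLinearMap
  have hL : LinearMap.ker L = ⊥ := by
    rw [LinearMap.ker_eq_bot']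
    intro v hv
    have h1 : ∀ w ∈ Submodule.span ℝ (P.root '' b.support), ⟪w, v⟫_ℝ = 0 := by
      intro w hw
      induction hw using Submodule.span_induction with
      | mem w hw =>
        obtain ⟨i, hi, rfl⟩ := hw
        exact congrFun hv ⟨i, hi⟩
      | zero => simp
      | add x y _ _ hx hy => rw [inner_add_left, hx, hy, add_zero]
      | smul c x _ hx => rw [inner_smul_left, hx, mul_zero]
    have h2 := h1 v (by rw [b.span_root_support]; exact (IsRootSystem.span_root_eq_top (P := P)).ge trivial)
    exact inner_self_eq_zero.1 h2
  obtain ⟨K, -, hK⟩ := L.exists_antilipschitzWith hL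
  refine (hK.isBounded_preimage (Metric.isBounded_closedBall (x := 0) (r := 1))).subset ?_
  intro v hv
  rw [Set.mem_preimage, mem_closedBall_zero_iff, pi_norm_le_iff_of_nonneg zero_le_one]
  intro i
  have := b.inner_mem_Ioo_of_mem_alcove hv (b.isPos_of_mem_support i.2)
  change ‖⟪P.root i, v⟫_ℝ‖ ≤ 1
  rw [Real.norm_eq_abs, abs_le]
  exact ⟨by linarith [this.1], this.2.le⟩

/-- Smooth functions invariant under the affine Weyl group satisfy the Neumann boundary condition
on the walls of the alcove. -/
theorem IsEuclidean.fderiv_root_eq_zero (hP : P.IsEuclidean) (b : P.Base) {f : V → ℂ}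
    (hf : Differentiable ℝ f) (hfG : ∀ w ∈ P.affineWeylGroup, ∀ v, f (w v) = f v) {i : ι} {v : V}
    (hv : ⟪P.root i, v⟫_ℝ + b.alcoveOffset i = 0) : fderiv ℝ f v (P.root i) = 0 := by
  -- The affine reflection in the wall through `v`. The offsets make the pairing with `v` equal to
  -- `0` or `-1`, so at most a translation by one negated coroot is needed.
  obtain ⟨w, hw, hwx⟩ : ∃ w ∈ P.affineWeylGroup,
      ∀ x, w x = P.reflection i x + ⟪P.root i, v⟫_ℝ • P.coroot i := by
    have hr : (P.reflection i).toAffineEquiv ∈ P.affineWeylGroup :=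
      Subgroup.subset_closure (Or.inl ⟨i, rfl⟩)
    have ht : AffineEquiv.constVAdd ℝ V (P.coroot i) ∈ P.affineWeylGroup :=
      Subgroup.subset_closure (Or.inr ⟨i, rfl⟩)
    by_cases hi : b.IsPos i
    · have h0 : ⟪P.root i, v⟫_ℝ = 0 := by simpa [Base.alcoveOffset, hi] using hv
      exact ⟨_, hr, fun x => by simp [h0]⟩
    · have h0 : ⟪P.root i, v⟫_ℝ = -1 := by
        simp only [Base.alcoveOffset, hi, if_false] at hv
        linarith
      refine ⟨_, mul_mem (inv_mem ht) hr, fun x => ?_⟩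
      have : (AffineEquiv.constVAdd ℝ V (P.coroot i))⁻¹
          = AffineEquiv.constVAdd ℝ V (-P.coroot i) := by
        rw [← AffineEquiv.constVAdd_symm]; rfl
      simp [this, h0, add_comm]
  have hwv : w v = v := by
    rw [hwx, hP.reflection_apply_eq]
    abel
  let r : V →L[ℝ] V := ContinuousLinearMap.id ℝ V - (innerSL ℝ (P.root i)).smulRight (P.coroot i)
  have hcomp : f = fun x => f (r x + ⟪P.root i, v⟫_ℝ • P.coroot i) := by
    funext x
    rw [← hfG w hw x, hwx, hP.reflection_apply_eq]
    rfl
  have hd : HasFDerivAt (fun x => f (r x + ⟪P.root i, v⟫_ℝ • P.coroot i))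
      ((fderiv ℝ f v).comp r) v := by
    have h1 : HasFDerivAt (fun x => r x + ⟪P.root i, v⟫_ℝ • P.coroot i) r v :=
      r.hasFDerivAt.add_const _
    have h2 : r v + ⟪P.root i, v⟫_ℝ • P.coroot i = v := by
      simp [r]
    exact HasFDerivAt.comp v (h2.symm ▸ (hf v).hasFDerivAt) h1
  rw [← hcomp] at hd
  have h1 := hd.fderiv
  -- Differentiating the invariance at the fixed point `v` in the normal direction makes the
  -- derivative its own negative.
  have h2 : r (P.root i) = -P.root i := by
    have := P.reflection_apply_self i
    rwa [hP.reflection_apply_eq] at this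
  have h3 : fderiv ℝ f v (P.root i) = -fderiv ℝ f v (P.root i) := by
    conv_lhs => rw [h1]
    rw [ContinuousLinearMap.comp_apply, h2, map_neg]
  exact self_eq_neg.1 h3

end Euclidean

end RootPairing

/-! ### Cutoff functions for polytopes -/

/-- A smooth step function, vanishing on `(-∞, 1]` and equal to one on `[2, ∞)`. -/
def smoothStep (t : ℝ) : ℝ := Real.smoothTransition (t - 1)

theorem contDiff_smoothStep : ContDiff ℝ ∞ smoothStep :=
  Real.smoothTransition.contDiff.comp (contDiff_id.sub contDiff_const)

theorem smoothStep_nonneg (t : ℝ) : 0 ≤ smoothStep t := Real.smoothTransition.nonneg _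

theorem smoothStep_le_one (t : ℝ) : smoothStep t ≤ 1 := Real.smoothTransition.le_one _

theorem smoothStep_eq_zero {t : ℝ} (ht : t ≤ 1) : smoothStep t = 0 :=
  Real.smoothTransition.zero_of_nonpos (by linarith)

theorem smoothStep_eq_one {t : ℝ} (ht : 2 ≤ t) : smoothStep t = 1 :=
  Real.smoothTransition.one_of_one_le (by linarith)

theorem deriv_smoothStep_eq_zero_of_lt {t : ℝ} (ht : 2 < t) : deriv smoothStep t = 0 := by
  have : smoothStep =ᶠ[𝓝 t] fun _ => 1 := by
    filter_upwards [lt_mem_nhds ht] with x hx using smoothStep_eq_one hx.le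
  rw [this.deriv_eq]
  simp

theorem deriv_smoothStep_eq_zero_of_lt_one {t : ℝ} (ht : t < 1) : deriv smoothStep t = 0 := by
  have : smoothStep =ᶠ[𝓝 t] fun _ => 0 := by
    filter_upwards [gt_mem_nhds ht] with x hx using smoothStep_eq_zero hx.le
  rw [this.deriv_eq]
  simp

theorem exists_abs_deriv_smoothStep_le : ∃ M, 0 ≤ M ∧ ∀ t, |deriv smoothStep t| ≤ M := by
  have hc : Continuous (deriv smoothStep) :=
    contDiff_smoothStep.continuous_deriv (by simp)
  obtain ⟨M, hM⟩ := (isCompact_Icc (a := (1 : ℝ)) (b := 2)).exists_bound_of_continuousOn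
    hc.continuousOn
  have hM0 : 0 ≤ M := (norm_nonneg _).trans (hM 1 ⟨le_rfl, by norm_num⟩)
  refine ⟨M, hM0, fun t => ?_⟩
  rcases lt_or_ge t 1 with h1 | h1
  · simpa [deriv_smoothStep_eq_zero_of_lt_one h1]
  rcases le_or_gt t 2 with h2 | h2
  · exact hM t ⟨h1, h2⟩
  · simpa [deriv_smoothStep_eq_zero_of_lt h2]

section Cutoff

variable {ι V : Type*} [Fintype ι] [DecidableEq ι] [NormedAddCommGroup V] [InnerProductSpace ℝ V]
  (a : ι → V) (e : ι → ℝ)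

/-- A smooth cutoff function at scale `1 / r` for the polytope `{v | ∀ i, 0 < ⟪a i, v⟫ + e i}`. -/
def polytopeCutoff (r : ℝ) (v : V) : ℝ := ∏ i, smoothStep (r * (⟪a i, v⟫_ℝ + e i))

/-- The coefficient of `a i` in the gradient of `polytopeCutoff`. -/
def polytopeCutoffCoeff (r : ℝ) (i : ι) (v : V) : ℝ :=
  (∏ k ∈ Finset.univ.erase i, smoothStep (r * (⟪a k, v⟫_ℝ + e k))) *
    (deriv smoothStep (r * (⟪a i, v⟫_ℝ + e i)) * r)

omit [DecidableEq ι] in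
theorem contDiff_polytopeCutoff (r : ℝ) : ContDiff ℝ ∞ (polytopeCutoff a e r) := by
  unfold polytopeCutoff
  exact contDiff_prod fun i _ => contDiff_smoothStep.comp
    (contDiff_const.mul ((contDiff_const.inner ℝ contDiff_id).add contDiff_const))

omit [DecidableEq ι] in
theorem polytopeCutoff_mem_Icc (r : ℝ) (v : V) : polytopeCutoff a e r v ∈ Set.Icc (0 : ℝ) 1 :=
  ⟨Finset.prod_nonneg fun _ _ => smoothStep_nonneg _,
    Finset.prod_le_one (fun _ _ => smoothStep_nonneg _) fun _ _ => smoothStep_le_one _⟩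

theorem fderiv_polytopeCutoff (r : ℝ) (v η : V) :
    fderiv ℝ (polytopeCutoff a e r) v η
      = ∑ i, polytopeCutoffCoeff a e r i v * ⟪a i, η⟫_ℝ := by
  have h1 (i : ι) : HasFDerivAt (fun v => smoothStep (r * (⟪a i, v⟫_ℝ + e i)))
      ((deriv smoothStep (r * (⟪a i, v⟫_ℝ + e i)) * r) • innerSL ℝ (a i)) v := by
    have h2 : HasFDerivAt (fun v => r * (⟪a i, v⟫_ℝ + e i)) (r • innerSL ℝ (a i)) v :=
      (((innerSL ℝ (a i)).hasFDerivAt).add_const (e i)).const_mul r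
    have h3 : HasDerivAt smoothStep (deriv smoothStep (r * (⟪a i, v⟫_ℝ + e i)))
        (r * (⟪a i, v⟫_ℝ + e i)) :=
      (contDiff_smoothStep.differentiable (by simp) _).hasDerivAt
    have := h3.comp_hasFDerivAt v h2
    rwa [smul_smul] at this
  have h4 := HasFDerivAt.finsetProd (u := Finset.univ) fun i _ => h1 i
  have h5 : fderiv ℝ (polytopeCutoff a e r) v = _ := h4.fderiv
  rw [h5]
  simp only [sum_apply, smul_apply, innerSL_apply_apply,
    smul_eq_mul, polytopeCutoffCoeff, mul_assoc]

omit [DecidableEq ι] in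
theorem tsupport_polytopeCutoff_subset {r : ℝ} (hr : 0 < r) :
    tsupport (polytopeCutoff a e r) ⊆ {v | ∀ i, 0 < ⟪a i, v⟫_ℝ + e i} := by
  -- The step function vanishes up to `1`, not only up to `0`; this keeps the closed support off the
  -- walls.
  have hcl : IsClosed {v : V | ∀ i, 1 / r ≤ ⟪a i, v⟫_ℝ + e i} := by
    rw [Set.ofPred_forall]
    exact isClosed_iInter fun i => isClosed_le continuous_const (by fun_prop)
  refine (closure_minimal ?_ hcl).trans fun v hv i => (by positivity : 0 < 1 / r).trans_le (hv i)
  intro v hv i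
  by_contra h
  push Not at h
  refine hv (Finset.prod_eq_zero (Finset.mem_univ i) (smoothStep_eq_zero ?_))
  rw [lt_div_iff₀ hr] at h
  linarith

omit [DecidableEq ι] in
theorem eventually_polytopeCutoff_eq_one {v : V} (hv : ∀ i, 0 < ⟪a i, v⟫_ℝ + e i) :
    ∀ᶠ r in atTop, polytopeCutoff a e r v = 1 := by
  have : ∀ i, ∀ᶠ r : ℝ in atTop, 2 ≤ r * (⟪a i, v⟫_ℝ + e i) := fun i =>
    (tendsto_id.atTop_mul_const (hv i)).eventually_ge_atTop 2
  filter_upwards [eventually_all.2 this] with r hr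
  exact Finset.prod_eq_one fun i _ => smoothStep_eq_one (hr i)

theorem eventually_polytopeCutoffCoeff_eq_zero {v : V} (i : ι) (hv : 0 < ⟪a i, v⟫_ℝ + e i) :
    ∀ᶠ r in atTop, polytopeCutoffCoeff a e r i v = 0 := by
  filter_upwards [(tendsto_id.atTop_mul_const hv).eventually_gt_atTop 2] with r hr
  rw [id_eq] at hr
  rw [polytopeCutoffCoeff, deriv_smoothStep_eq_zero_of_lt hr]
  simp

/-- The coefficient is at most `M * r` and vanishes where `r * (⟪a i, v⟫ + e i) > 2`. The bound does
not depend on `r`, so the cutoff gradient is harmless against a function of the order of the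
distance to the wall. -/
theorem abs_polytopeCutoffCoeff_mul_le {M : ℝ} (hM0 : 0 ≤ M) (hM : ∀ t, |deriv smoothStep t| ≤ M)
    {r : ℝ} (hr : 0 < r) (i : ι) {v : V} (hv : 0 < ⟪a i, v⟫_ℝ + e i) :
    |polytopeCutoffCoeff a e r i v| * (⟪a i, v⟫_ℝ + e i) ≤ 2 * M := by
  have hp0 : 0 ≤ ∏ k ∈ Finset.univ.erase i, smoothStep (r * (⟪a k, v⟫_ℝ + e k)) :=
    Finset.prod_nonneg fun _ _ => smoothStep_nonneg _
  have hp1 : ∏ k ∈ Finset.univ.erase i, smoothStep (r * (⟪a k, v⟫_ℝ + e k)) ≤ 1 :=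
    Finset.prod_le_one (fun _ _ => smoothStep_nonneg _) fun _ _ => smoothStep_le_one _
  rw [polytopeCutoffCoeff, abs_mul, abs_of_nonneg hp0, abs_mul, abs_of_pos hr, mul_assoc, mul_assoc]
  refine (mul_le_of_le_one_left (by positivity) hp1).trans ?_
  rcases le_or_gt (r * (⟪a i, v⟫_ℝ + e i)) 2 with h | h
  · calc _ ≤ M * 2 := mul_le_mul (hM _) h (by positivity) hM0
      _ = 2 * M := mul_comm _ _
  · rw [deriv_smoothStep_eq_zero_of_lt h]
    simpa using hM0

end Cutoff

/-! ### Green's formula -/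

section Green

variable {V : Type*} [NormedAddCommGroup V] [InnerProductSpace ℝ V] [FiniteDimensional ℝ V]

/-- The Laplacian is the sum of the iterated directional derivatives. -/
theorem laplacian_eq_sum_fderiv_fderiv {κ : Type*} [Fintype κ] (η : OrthonormalBasis κ ℝ V)
    {g : V → ℂ} (hg : ContDiff ℝ ∞ g) (v : V) :
    Laplacian.laplacian g v
      = ∑ j, fderiv ℝ (fun x => fderiv ℝ g x (η j)) v (η j) := by
  rw [InnerProductSpace.laplacian_eq_iteratedFDeriv_orthonormalBasis g η]
  refine Finset.sum_congr rfl fun j _ => ?_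
  have hd : DifferentiableAt ℝ (fderiv ℝ g) v :=
    (hg.fderiv_right (m := ∞) le_rfl).differentiable (by simp) v
  rw [iteratedFDeriv_two_apply, fderiv_clm_apply hd (differentiableAt_const _)]
  simp

/-- A directional derivative which vanishes on the wall `⟪a, v⟫ + c = 0` is bounded by the
distance to the wall on bounded sets. -/
theorem exists_norm_le_mul_inner_add {h : V → ℂ} (hh : ContDiff ℝ ∞ h) {a : V} (ha : a ≠ 0)
    {c : ℝ} (h0 : ∀ v, ⟪a, v⟫_ℝ + c = 0 → h v = 0) {A : Set V} (hA : Bornology.IsBounded A) :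
    ∃ C, 0 ≤ C ∧ ∀ v ∈ A, 0 < ⟪a, v⟫_ℝ + c → ‖h v‖ ≤ C * (⟪a, v⟫_ℝ + c) := by
  -- The orthogonal projection to the wall. The mean value inequality is applied between `p v` and
  -- `v`, in a ball since a ball contains the segment joining them.
  let p : V → V := fun v => v - ((⟪a, v⟫_ℝ + c) / ‖a‖ ^ 2) • a
  have hn : 0 < ‖a‖ := norm_pos_iff.2 ha
  have hpw (v : V) : ⟪a, p v⟫_ℝ + c = 0 := by
    simp only [p, inner_sub_right, inner_smul_right, real_inner_self_eq_norm_sq]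
    field_simp
    ring
  have hpc : Continuous p := by fun_prop
  have hcomp : IsCompact (closure A ∪ p '' closure A) :=
    hA.isCompact_closure.union (hA.isCompact_closure.image hpc)
  obtain ⟨R, hR⟩ := hcomp.isBounded.subset_closedBall (0 : V)
  have hK : IsCompact (Metric.closedBall (0 : V) R) := isCompact_closedBall _ _
  have hC1 : ContDiff ℝ 1 h := hh.of_le (by simp)
  obtain ⟨K, hKb⟩ := hK.exists_bound_of_continuousOn
    (hC1.continuous_fderiv one_ne_zero).continuousOn
  refine ⟨max K 0 / ‖a‖, by positivity, fun v hv hpos => ?_⟩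
  have hvR : v ∈ Metric.closedBall (0 : V) R := hR (Or.inl (subset_closure hv))
  have hpR : p v ∈ Metric.closedBall (0 : V) R := hR (Or.inr ⟨v, subset_closure hv, rfl⟩)
  have hl := (convex_closedBall (0 : V) R).norm_image_sub_le_of_norm_fderiv_le
    (fun x _ => hC1.differentiable one_ne_zero x) (fun x hx => (hKb x hx).trans (le_max_left K 0))
    hpR hvR
  rw [h0 _ (hpw v), sub_zero] at hl
  refine hl.trans_eq ?_
  have : ‖v - p v‖ = (⟪a, v⟫_ℝ + c) / ‖a‖ := by
    simp only [p, sub_sub_cancel, norm_smul, Real.norm_eq_abs]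
    rw [abs_of_pos (by positivity)]
    field_simp
  rw [this]
  ring

variable [MeasurableSpace V] [BorelSpace V]

theorem L2On.integrable_fun_mul {A : Set V} (f : L2On A) {ψ : V → ℂ}
    (hψ : MemLp ψ 2 (volume.restrict A)) :
    Integrable (fun v => ψ v * f v) (volume.restrict A) :=
  hψ.integrable_mul (Lp.memLp f)

/-- Weak derivatives can be tested against complex valued test functions. -/
theorem HasWeakDeriv.integral_fderiv_mul {A : Set V} {η : V} {f g : L2On A}
    (h : HasWeakDeriv A η f g) {ψ : V → ℂ} (hψ : ContDiff ℝ ∞ ψ) (hc : HasCompactSupport ψ)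
    (hs : tsupport ψ ⊆ A) :
    ∫ v in A, fderiv ℝ ψ v η * f v = -∫ v in A, ψ v * g v := by
  -- To be used for the real and the imaginary part, which are real test functions.
  have key (L : ℂ →L[ℝ] ℝ) :
      ∫ v in A, ((L (fderiv ℝ ψ v η) : ℝ) : ℂ) * f v = -∫ v in A, ((L (ψ v) : ℝ) : ℂ) * g v := by
    have h1 : tsupport (fun v => L (ψ v)) ⊆ tsupport ψ :=
      closure_mono fun v hv hψv => hv (by simp [hψv])
    have h2 := h (fun v => L (ψ v)) (L.contDiff.comp hψ) (hc.comp_left (map_zero L)) (h1.trans hs)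
    have h3 (v : V) : fderiv ℝ (fun v => L (ψ v)) v η = L (fderiv ℝ ψ v η) := by
      have := (L.hasFDerivAt.comp v (hψ.differentiable (by simp) v).hasFDerivAt).fderiv
      exact congrArg (fun T : V →L[ℝ] ℝ => T η) this
    simpa only [h3, Complex.real_smul] using h2
  have hint {ξ : V → ℂ} (hξ : Continuous ξ) (hξc : HasCompactSupport ξ) (L : ℂ →L[ℝ] ℝ)
      (k : L2On A) : Integrable (fun v => ((L (ξ v) : ℝ) : ℂ) * k v) (volume.restrict A) := by
    refine L2On.integrable_fun_mul k (Continuous.memLp_of_hasCompactSupport (by fun_prop) ?_)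
    exact hξc.comp_left (g := fun z => ((L z : ℝ) : ℂ)) (by simp)
  have hsplit {ξ : V → ℂ} (hξ : Continuous ξ) (hξc : HasCompactSupport ξ) (k : L2On A) :
      ∫ v in A, ξ v * k v = (∫ v in A, ((Complex.reCLM (ξ v) : ℝ) : ℂ) * k v)
        + Complex.I * ∫ v in A, ((Complex.imCLM (ξ v) : ℝ) : ℂ) * k v := by
    rw [← integral_const_mul, ← integral_add (hint hξ hξc _ k) ((hint hξ hξc _ k).const_mul _)]
    refine integral_congr_ae (ae_of_all _ fun v => ?_)
    dsimp only
    conv_lhs => rw [← Complex.re_add_im (ξ v)]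
    simp only [Complex.reCLM_apply, Complex.imCLM_apply]
    ring
  have hd : Continuous fun v => fderiv ℝ ψ v η :=
    (hψ.continuous_fderiv (by simp)).clm_apply continuous_const
  have hdc : HasCompactSupport fun v => fderiv ℝ ψ v η := hc.fderiv_apply ℝ η
  rw [hsplit hd hdc, hsplit hψ.continuous hc, key, key]
  ring

theorem MeasureTheory.memLp_restrict_of_continuous {A : Set V} (hAm : MeasurableSet A)
    (hb : Bornology.IsBounded A) [IsFiniteMeasure ((volume : Measure V).restrict A)] {ψ : V → ℂ}
    (hψ : Continuous ψ) : MemLp ψ 2 (volume.restrict A) := by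
  obtain ⟨C, hC⟩ := hb.isCompact_closure.exists_bound_of_continuousOn hψ.continuousOn
  refine MemLp.of_bound hψ.aestronglyMeasurable C ?_
  filter_upwards [ae_restrict_mem hAm] with v hv using hC v (subset_closure hv)

/-- Green's formula on a bounded polytope for a function in the Sobolev space and a smooth function
with vanishing normal derivatives on the walls. -/
theorem sum_integral_fderiv_mul_eq_neg_integral_laplacian_mul {ι : Type*} [Finite ι]
    {a : ι → V} {e : ι → ℝ} (ha : ∀ i, a i ≠ 0) {A : Set V}
    (hA : A = {v | ∀ i, 0 < ⟪a i, v⟫_ℝ + e i}) (hb : Bornology.IsBounded A)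
    {g : V → ℂ} (hg : ContDiff ℝ ∞ g)
    (hN : ∀ i v, ⟪a i, v⟫_ℝ + e i = 0 → fderiv ℝ g v (a i) = 0)
    {κ : Type*} [Fintype κ] (η : OrthonormalBasis κ ℝ V) {f : L2On A} {F : κ → L2On A}
    (hF : ∀ j, HasWeakDeriv A (η j) f (F j)) :
    ∑ j, ∫ v in A, fderiv ℝ g v (η j) * F j v = -∫ v in A, Laplacian.laplacian g v * f v := by
  classical
  have := Fintype.ofFinite ι
  have hAo : IsOpen A := by
    rw [hA, Set.ofPred_forall]
    exact isOpen_iInter_of_finite fun i => isOpen_lt continuous_const (by fun_prop)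
  have hAm := hAo.measurableSet
  have hmem {v : V} (hv : v ∈ A) (i : ι) : 0 < ⟪a i, v⟫_ℝ + e i := by
    rw [hA] at hv; exact hv i
  have hfin : IsFiniteMeasure ((volume : Measure V).restrict A) :=
    isFiniteMeasure_restrict.2 hb.measure_lt_top.ne
  have hdg (x : V) : ContDiff ℝ ∞ fun v => fderiv ℝ g v x :=
    (hg.fderiv_right (m := ∞) le_rfl).clm_apply contDiff_const
  have hddg (j : κ) : Continuous fun v => fderiv ℝ (fun x => fderiv ℝ g x (η j)) v (η j) :=
    ((hdg _).continuous_fderiv (by simp)).clm_apply continuous_const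
  have hlap : Continuous fun v => Laplacian.laplacian g v := by
    simp_rw [laplacian_eq_sum_fderiv_fderiv η hg]
    exact continuous_finsetSum _ fun j _ => hddg j
  -- The scale `n + 1` is positive for every `n`, as the support lemma requires.
  let φ : ℕ → V → ℝ := fun n => polytopeCutoff a e (n + 1)
  let c : ℕ → ι → V → ℝ := fun n => polytopeCutoffCoeff a e (n + 1)
  have hr : Tendsto (fun n : ℕ => (n : ℝ) + 1) atTop atTop :=
    tendsto_atTop_add_const_right _ _ tendsto_natCast_atTop_atTop
  have hφs (n : ℕ) : ContDiff ℝ ∞ (φ n) := contDiff_polytopeCutoff a e _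
  have hφt (n : ℕ) : tsupport (φ n) ⊆ A := by
    rw [hA]; exact tsupport_polytopeCutoff_subset a e (by positivity)
  have hφc (n : ℕ) : HasCompactSupport (φ n) :=
    Metric.isCompact_of_isClosed_isBounded (isClosed_tsupport _) (hb.subset (hφt n))
  have hφb (n : ℕ) (v : V) : ‖((φ n v : ℝ) : ℂ)‖ ≤ 1 := by
    have := polytopeCutoff_mem_Icc a e (n + 1) v
    rw [Complex.norm_real, Real.norm_eq_abs, abs_of_nonneg this.1]
    exact this.2
  have hφ1 {v : V} (hv : v ∈ A) : ∀ᶠ n in atTop, φ n v = 1 :=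
    hr.eventually (eventually_polytopeCutoff_eq_one a e (hmem hv))
  have hcc (n : ℕ) (i : ι) : Continuous (c n i) := by
    have hc1 : Continuous (deriv smoothStep) :=
      contDiff_smoothStep.continuous_deriv (by simp)
    have hc2 := contDiff_smoothStep.continuous
    unfold c polytopeCutoffCoeff
    fun_prop
  -- the formula with a cutoff
  have hcut (n : ℕ) : ∫ v in A, ((∑ i, (c n i v : ℂ) * fderiv ℝ g v (a i))
      + (φ n v : ℂ) * Laplacian.laplacian g v) * f v
      = -∑ j, ∫ v in A, ((φ n v : ℂ) * fderiv ℝ g v (η j)) * F j v := by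
    have hφC : ContDiff ℝ ∞ fun v => ((φ n v : ℝ) : ℂ) :=
      Complex.ofRealCLM.contDiff.comp (hφs n)
    have h1 (j : κ) : ∫ v in A, fderiv ℝ (fun v => (φ n v : ℂ) * fderiv ℝ g v (η j)) v (η j) * f v
        = -∫ v in A, ((φ n v : ℂ) * fderiv ℝ g v (η j)) * F j v := by
      have ht : tsupport (fun v => (φ n v : ℂ) * fderiv ℝ g v (η j)) ⊆ tsupport (φ n) :=
        closure_mono fun v hv h0 => hv (by simp [h0])
      exact (hF j).integral_fderiv_mul (hφC.mul (hdg (η j)))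
        ((hφc n).mono' (subset_closure.trans ht)) (ht.trans (hφt n))
    have h2 (j : κ) (v : V) : fderiv ℝ (fun v => (φ n v : ℂ) * fderiv ℝ g v (η j)) v (η j)
        = ((∑ i, (c n i v : ℂ) * (⟪a i, η j⟫_ℝ : ℂ)) * fderiv ℝ g v (η j))
          + (φ n v : ℂ) * fderiv ℝ (fun x => fderiv ℝ g x (η j)) v (η j) := by
      rw [fderiv_fun_mul (hφC.differentiable (by simp) v) ((hdg _).differentiable (by simp) v)]
      have h3 : fderiv ℝ (fun v => ((φ n v : ℝ) : ℂ)) v (η j) = ((fderiv ℝ (φ n) v (η j) : ℝ) : ℂ) := by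
        have := (Complex.ofRealCLM.hasFDerivAt.comp v
          ((hφs n).differentiable (by simp) v).hasFDerivAt).fderiv
        exact congrArg (fun T : V →L[ℝ] ℂ => T (η j)) this
      simp only [add_apply, smul_apply, smul_eq_mul, h3]
      rw [fderiv_polytopeCutoff]
      push_cast
      ring
    have hint (j : κ) : Integrable (fun v =>
        fderiv ℝ (fun v => (φ n v : ℂ) * fderiv ℝ g v (η j)) v (η j) * f v)
        (volume.restrict A) := by
      refine L2On.integrable_fun_mul f (memLp_restrict_of_continuous hAm hb ?_)
      exact ((hφC.mul (hdg (η j))).continuous_fderiv (by simp)).clm_apply continuous_const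
    rw [← Finset.sum_neg_distrib, ← Finset.sum_congr rfl fun j _ => h1 j,
      ← integral_finsetSum _ fun j _ => hint j]
    refine integral_congr_ae (ae_of_all _ fun v => ?_)
    dsimp only
    rw [← Finset.sum_mul]
    congr 1
    simp_rw [h2]
    rw [Finset.sum_add_distrib, ← Finset.mul_sum, ← laplacian_eq_sum_fderiv_fderiv η hg]
    congr 1
    simp_rw [Finset.sum_mul]
    rw [Finset.sum_comm]
    refine Finset.sum_congr rfl fun i _ => ?_
    -- Summing over the orthonormal basis reassembles the derivative of `g` along the normal `a i`,
    -- the only component that meets the gradient of the cutoff.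
    have h4 : a i = ∑ j, ⟪a i, η j⟫_ℝ • η j := by
      conv_lhs => rw [← η.sum_repr' (a i)]
      exact Finset.sum_congr rfl fun j _ => by rw [real_inner_comm]
    conv_lhs => rw [h4]
    rw [map_sum, Finset.mul_sum]
    refine Finset.sum_congr rfl fun j _ => ?_
    rw [map_smul, Complex.real_smul, mul_assoc]
  obtain ⟨M, hM0, hM⟩ := exists_abs_deriv_smoothStep_le
  choose C hC0 hC using fun i => exists_norm_le_mul_inner_add (hdg (a i)) (ha i) (hN i) hb
  obtain ⟨B, hB⟩ := hb.isCompact_closure.exists_bound_of_continuousOn hlap.continuousOn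
  -- Each product of a cutoff coefficient and a normal derivative is bounded by `2 * M * C i`
  -- uniformly in `n`, and at a fixed point of `A` it is eventually zero.
  have hlim1 : Tendsto (fun n => ∫ v in A, ((∑ i, (c n i v : ℂ) * fderiv ℝ g v (a i))
      + (φ n v : ℂ) * Laplacian.laplacian g v) * f v) atTop
      (𝓝 (∫ v in A, Laplacian.laplacian g v * f v)) := by
    refine tendsto_integral_of_dominated_convergence
      (fun v => ((∑ i, 2 * M * C i) + B) * ‖f v‖) (fun n => ?_) ?_ (fun n => ?_) ?_
    · refine AEStronglyMeasurable.mul ?_ (Lp.aestronglyMeasurable f)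
      refine Continuous.aestronglyMeasurable ?_
      have h1 := (hφs n).continuous
      have h2 (i : ι) := (hdg (a i)).continuous
      have h3 := hcc n
      fun_prop
    · exact (((Lp.memLp f).integrable (by norm_num)).norm).const_mul _
    · filter_upwards [ae_restrict_mem hAm] with v hv
      rw [norm_mul]
      refine mul_le_mul_of_nonneg_right ((norm_add_le _ _).trans (add_le_add ?_ ?_)) (norm_nonneg _)
      · refine (norm_sum_le _ _).trans (Finset.sum_le_sum fun i _ => ?_)
        rw [norm_mul, Complex.norm_real, Real.norm_eq_abs]
        have h1 := hC i v hv (hmem hv i)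
        have h2 := abs_polytopeCutoffCoeff_mul_le a e hM0 hM (r := n + 1) (by positivity) i
          (hmem hv i)
        calc |c n i v| * ‖fderiv ℝ g v (a i)‖ ≤ |c n i v| * (C i * (⟪a i, v⟫_ℝ + e i)) :=
              mul_le_mul_of_nonneg_left h1 (abs_nonneg _)
          _ = (|c n i v| * (⟪a i, v⟫_ℝ + e i)) * C i := by ring
          _ ≤ 2 * M * C i := mul_le_mul_of_nonneg_right h2 (hC0 i)
      · rw [norm_mul]
        exact (mul_le_of_le_one_left (norm_nonneg _) (hφb n v)).trans (hB v (subset_closure hv))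
    · filter_upwards [ae_restrict_mem hAm] with v hv
      refine tendsto_const_nhds.congr' ?_
      have hc0 : ∀ᶠ n in atTop, ∀ i, c n i v = 0 := eventually_all.2 fun i =>
        hr.eventually (eventually_polytopeCutoffCoeff_eq_zero a e i (hmem hv i))
      filter_upwards [hc0, hφ1 hv] with n h1 h2
      simp [h1, h2]
  have hlim2 : Tendsto (fun n => -∑ j, ∫ v in A, ((φ n v : ℂ) * fderiv ℝ g v (η j)) * F j v) atTop
      (𝓝 (-∑ j, ∫ v in A, fderiv ℝ g v (η j) * F j v)) := by
    refine (tendsto_finsetSum _ fun j _ => ?_).neg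
    have hI : Integrable (fun v => fderiv ℝ g v (η j) * F j v) (volume.restrict A) :=
      L2On.integrable_fun_mul (F j) (memLp_restrict_of_continuous hAm hb (hdg _).continuous)
    refine tendsto_integral_of_dominated_convergence
      (fun v => ‖fderiv ℝ g v (η j) * F j v‖) (fun n => ?_) hI.norm (fun n => ?_) ?_
    · refine AEStronglyMeasurable.mul ?_ (Lp.aestronglyMeasurable _)
      refine Continuous.aestronglyMeasurable ?_
      have h1 := (hφs n).continuous
      have h2 := (hdg (η j)).continuous
      fun_prop
    · refine ae_of_all _ fun v => ?_
      rw [mul_assoc, norm_mul]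
      exact mul_le_of_le_one_left (norm_nonneg _) (hφb n v)
    · filter_upwards [ae_restrict_mem hAm] with v hv
      refine tendsto_const_nhds.congr' ?_
      filter_upwards [hφ1 hv] with n h2
      simp [h2]
  have := tendsto_nhds_unique (hlim1.congr hcut) hlim2
  rw [this, neg_neg]

end Green

/-! ### Plane waves -/

section PlaneWave

variable {V : Type*} [NormedAddCommGroup V] [InnerProductSpace ℝ V]

/-- The plane wave `v ↦ exp (2 π i ⟪l, v⟫)`. -/
def planeWave (l v : V) : ℂ := Complex.exp ((2 * Real.pi * Complex.I) * (⟪l, v⟫_ℝ : ℂ))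

theorem contDiff_planeWave (l : V) : ContDiff ℝ ∞ (planeWave l) := by
  have h : ContDiff ℝ ∞ fun v => ((⟪l, v⟫_ℝ : ℝ) : ℂ) :=
    Complex.ofRealCLM.contDiff.comp (innerSL ℝ l).contDiff
  exact (contDiff_const.mul h).cexp

theorem planeWave_add (l v w : V) : planeWave l (v + w) = planeWave l v * planeWave l w := by
  rw [planeWave, planeWave, planeWave, ← Complex.exp_add, inner_add_right]
  push_cast
  ring_nf

theorem planeWave_eq_one {l v : V} {z : ℤ} (h : ⟪l, v⟫_ℝ = z) : planeWave l v = 1 := by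
  rw [planeWave, h]
  have := Complex.exp_int_mul_two_pi_mul_I z
  rw [← this]
  push_cast
  ring_nf

theorem fderiv_planeWave (l v x : V) : fderiv ℝ (planeWave l) v x
    = (2 * Real.pi * Complex.I * (⟪l, x⟫_ℝ : ℂ)) * planeWave l v := by
  have h1 : HasFDerivAt (fun v => ((⟪l, v⟫_ℝ : ℝ) : ℂ)) (Complex.ofRealCLM.comp (innerSL ℝ l)) v :=
    Complex.ofRealCLM.hasFDerivAt.comp v (innerSL ℝ l).hasFDerivAt
  have h2 := ((h1.const_mul (2 * Real.pi * Complex.I)).cexp).fderiv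
  have h3 : fderiv ℝ (planeWave l) v x = _ := congrArg (fun T : V →L[ℝ] ℂ => T x) h2
  rw [h3]
  simp [planeWave]
  ring

theorem laplacian_planeWave [FiniteDimensional ℝ V] (l v : V) :
    Laplacian.laplacian (planeWave l) v
      = -((2 * Real.pi * ‖l‖) ^ 2 : ℝ) * planeWave l v := by
  rw [laplacian_eq_sum_fderiv_fderiv (stdOrthonormalBasis ℝ V) (contDiff_planeWave l)]
  have h (x : V) : fderiv ℝ (fun v => fderiv ℝ (planeWave l) v x) v x
      = -((2 * Real.pi) ^ 2 * ⟪l, x⟫_ℝ ^ 2 : ℝ) * planeWave l v := by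
    simp_rw [fderiv_planeWave]
    rw [fderiv_const_mul ((contDiff_planeWave l).differentiable (by simp) v)]
    rw [smul_apply, fderiv_planeWave, smul_eq_mul]
    push_cast
    ring_nf
    rw [Complex.I_sq]
    ring
  simp_rw [h]
  rw [← Finset.sum_mul, Finset.sum_neg_distrib, ← Complex.ofReal_sum, ← Finset.mul_sum,
    OrthonormalBasis.sum_sq_inner_left, mul_pow (2 * Real.pi)]

end PlaneWave

/-! ### Orbit sums of plane waves as invariant eigenfunctions -/

namespace RootPairing

variable {ι V : Type*} [NormedAddCommGroup V] [InnerProductSpace ℝ V] {P : RootPairing ι ℝ V V}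

/-- The sum of the plane waves over an orbit of the Weyl group. -/
def orbitSum (P : RootPairing ι ℝ V V) [Fintype P.linearWeylGroup] (l v : V) : ℂ :=
  ∑ u : P.linearWeylGroup, planeWave l (u.1 v)

/-- The lattice dual to the coroot lattice. -/
def weightLattice (P : RootPairing ι ℝ V V) : Set V :=
  {l | ∀ μ ∈ P.corootLattice, ∃ z : ℤ, ⟪l, μ⟫_ℝ = z}

theorem contDiff_orbitSum [FiniteDimensional ℝ V] [Fintype P.linearWeylGroup] (l : V) :
    ContDiff ℝ ∞ (P.orbitSum l) := by
  unfold orbitSum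
  exact ContDiff.sum fun u _ =>
    (contDiff_planeWave l).comp (LinearMap.toContinuousLinearMap (u.1 : V →ₗ[ℝ] V)).contDiff

namespace IsEuclidean

variable (hP : P.IsEuclidean)
include hP

/-- The linear part of `w` only permutes the summands. The translation part multiplies each one by a
phase, equal to `1` because the Weyl group preserves the coroot lattice. -/
theorem orbitSum_apply_affineWeylGroup [Fintype P.linearWeylGroup] {l : V}
    (hl : l ∈ P.weightLattice) {w : V ≃ᵃ[ℝ] V} (hw : w ∈ P.affineWeylGroup) (v : V) :
    P.orbitSum l (w v) = P.orbitSum l v := by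
  obtain ⟨u, hu, μ, hμ, h⟩ := hP.exists_apply_eq_of_mem_affineWeylGroup hw
  rw [orbitSum, orbitSum, h]
  refine (Finset.sum_congr rfl fun u' _ => ?_).trans
    (_root_.Equiv.sum_comp (Equiv.mulRight (⟨u, hu⟩ : P.linearWeylGroup))
      fun u' : P.linearWeylGroup => planeWave l (u'.1 v))
  obtain ⟨z, hz⟩ := hl _ (hP.apply_mem_corootLattice u'.2 hμ)
  rw [map_add, planeWave_add, planeWave_eq_one hz, mul_one]
  rfl

theorem planeWave_apply {u : V ≃ₗ[ℝ] V} (hu : u ∈ P.linearWeylGroup) (l v : V) :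
    planeWave l (u v) = planeWave (u⁻¹ l) v := by
  rw [planeWave, planeWave, ← hP.inner_apply_apply hu (u⁻¹ l) v]
  congr 4
  exact (u.apply_symm_apply l).symm

/-- Every summand is a plane wave with frequency `u⁻¹ l`, of the same length as `l`, so all summands
share one eigenvalue. -/
theorem laplacian_orbitSum [FiniteDimensional ℝ V] [Fintype P.linearWeylGroup] (l v : V) :
    Laplacian.laplacian (P.orbitSum l) v
      = -((2 * Real.pi * ‖l‖) ^ 2 : ℝ) * P.orbitSum l v := by
  have hn {u : V ≃ₗ[ℝ] V} (hu : u ∈ P.linearWeylGroup) : ‖u⁻¹ l‖ = ‖l‖ := by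
    rw [@norm_eq_sqrt_real_inner V, hP.inner_apply_apply (inv_mem hu), ← norm_eq_sqrt_real_inner]
  have h0 : P.orbitSum l = fun v => ∑ u : P.linearWeylGroup, planeWave (u.1⁻¹ l) v := by
    funext v
    exact Finset.sum_congr rfl fun u _ => hP.planeWave_apply u.2 l v
  have hd (l : V) : ContDiff ℝ ∞ fun v => fderiv ℝ (planeWave l) v :=
    (contDiff_planeWave l).fderiv_right (m := ∞) le_rfl
  have hs : ContDiff ℝ ∞ (P.orbitSum l) := contDiff_orbitSum l
  rw [laplacian_eq_sum_fderiv_fderiv (stdOrthonormalBasis ℝ V) hs, h0]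
  have h1 (x : V) : (fun y => fderiv ℝ (fun v => ∑ u : P.linearWeylGroup,
      planeWave (u.1⁻¹ l) v) y x) = fun y => ∑ u : P.linearWeylGroup,
        fderiv ℝ (planeWave (u.1⁻¹ l)) y x := by
    funext y
    rw [fderiv_fun_sum fun u _ => (contDiff_planeWave _).differentiable (by simp) y]
    rw [sum_apply]
  have h2 (x : V) : fderiv ℝ (fun y => ∑ u : P.linearWeylGroup,
        fderiv ℝ (planeWave (u.1⁻¹ l)) y x) v x = ∑ u : P.linearWeylGroup,
        fderiv ℝ (fun y => fderiv ℝ (planeWave (u.1⁻¹ l)) y x) v x := by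
    rw [fderiv_fun_sum fun u _ =>
      ((hd _).clm_apply contDiff_const).differentiable (by simp) v, sum_apply]
  simp_rw [h1, h2]
  rw [Finset.sum_comm, Finset.mul_sum]
  refine Finset.sum_congr rfl fun u _ => ?_
  rw [← laplacian_eq_sum_fderiv_fderiv _ (contDiff_planeWave _), laplacian_planeWave, hn u.2]

end IsEuclidean

/-! ### Fourier analysis on the torus and completeness of the orbit sums -/

section Torus

variable [P.IsRootSystem] (b : P.Base)

/-- The quotient map from `V` to the torus `V / Q^∨`, in coordinates given by the simple coroots. -/
def Base.toTorus (v : V) : UnitAddTorus b.support :=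
  fun i => ((b.toCoweightBasis.repr v i : ℝ) : UnitAddCircle)

theorem Base.continuous_toTorus [FiniteDimensional ℝ V] : Continuous b.toTorus := by
  refine continuous_pi fun i => (AddCircle.continuous_mk' 1).comp ?_
  exact (LinearMap.toContinuousLinearMap (b.toCoweightBasis.coord i)).continuous

theorem Base.sub_mem_corootLattice_of_toTorus_eq {v w : V} (h : b.toTorus v = b.toTorus w) :
    v - w ∈ P.corootLattice := by
  have h1 : ∀ i, ∃ n : ℤ, (n : ℝ) = b.toCoweightBasis.repr (v - w) i := by
    intro i
    have h2 : ((b.toCoweightBasis.repr v i - b.toCoweightBasis.repr w i : ℝ) : UnitAddCircle)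
        = 0 := by
      rw [AddCircle.coe_sub]
      exact sub_eq_zero.2 (congrFun h i)
    obtain ⟨n, hn⟩ := (AddCircle.coe_eq_zero_iff 1).1 h2
    exact ⟨n, by simpa using hn⟩
  choose n hn using h1
  rw [← b.toCoweightBasis.sum_repr (v - w)]
  refine sum_mem fun i _ => ?_
  rw [← hn i, Int.cast_smul_eq_zsmul, b.toCoweightBasis_apply]
  exact zsmul_mem (AddSubgroup.subset_closure (Set.mem_range_self _)) _

theorem Base.exists_repr_eq_int {μ : V} (hμ : μ ∈ P.corootLattice) (i : b.support) :
    ∃ z : ℤ, b.toCoweightBasis.repr μ i = z := by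
  have h1 : (Submodule.span ℤ (P.coroot '' b.support)).toAddSubgroup ≤
      (Int.castAddHom ℝ).range.comap (b.toCoweightBasis.coord i : V →+ ℝ) := by
    intro x hx
    induction hx using Submodule.span_induction with
    | mem x hx =>
      obtain ⟨j, hj, rfl⟩ := hx
      have := b.toCoweightBasis_repr_coroot ⟨j, hj⟩
      refine ⟨Finsupp.single (⟨j, hj⟩ : b.support) 1 i, ?_⟩
      change _ = b.toCoweightBasis.repr (P.coroot j) i
      rw [this]
      by_cases h : i = ⟨j, hj⟩
      · subst h; simp
      · simp [Finsupp.single_eq_of_ne h]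
    | zero => exact zero_mem _
    | add x y _ _ hx hy => exact add_mem hx hy
    | smul n x _ hx => exact zsmul_mem hx n
  have h2 : P.corootLattice ≤ (Submodule.span ℤ (P.coroot '' b.support)).toAddSubgroup := by
    rw [corootLattice, AddSubgroup.closure_le]
    rintro _ ⟨j, rfl⟩
    exact b.coroot_mem_span_int j
  obtain ⟨z, hz⟩ := h1 (h2 hμ)
  exact ⟨z, hz.symm⟩

/-- The Fourier monomials on the torus are the plane waves for the dual lattice. -/
theorem Base.exists_mFourier_toTorus_eq [FiniteDimensional ℝ V] (n : b.support → ℤ) :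
    ∃ l ∈ P.weightLattice, ∀ v, UnitAddTorus.mFourier n (b.toTorus v) = planeWave l v := by
  -- The frequency `l` is the Riesz representative of the functional with coefficients `n` in simple
  -- coroot coordinates; integrality on the coroot lattice puts it in the dual lattice.
  let L : V →ₗ[ℝ] ℝ := ∑ i, (n i : ℝ) • b.toCoweightBasis.coord i
  have hL (v : V) : L v = ∑ i, (n i : ℝ) * b.toCoweightBasis.repr v i := by simp [L]
  let l : V := (InnerProductSpace.toDual ℝ V).symm (LinearMap.toContinuousLinearMap L)
  have hl (v : V) : ⟪l, v⟫_ℝ = L v := by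
    rw [InnerProductSpace.toDual_symm_apply]
    rfl
  refine ⟨l, fun μ hμ => ?_, fun v => ?_⟩
  · choose z hz using b.exists_repr_eq_int hμ
    refine ⟨∑ i, n i * z i, ?_⟩
    rw [hl, hL]
    push_cast
    exact Finset.sum_congr rfl fun i _ => by rw [hz]
  · rw [planeWave, hl, hL]
    push_cast
    rw [Finset.mul_sum, Complex.exp_sum]
    refine Finset.prod_congr rfl fun i _ => ?_
    rw [toTorus, fourier_coe_apply]
    congr 1
    push_cast
    ring

variable [FiniteDimensional ℝ V] [MeasurableSpace V] [BorelSpace V] [Finite ι]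
  [P.IsCrystallographic] [P.IsReduced]

-- The integral is a continuous linear functional of `ψ`. On a Fourier monomial it is an integral
-- against an orbit sum, hence zero, and the monomials span a dense subspace.
omit [Finite ι] [P.IsCrystallographic] [P.IsReduced] in
theorem Base.integral_mul_sum_toTorus_eq_zero [Fintype P.linearWeylGroup] {ν : Measure V} {f : V → ℂ} (hf : Integrable f ν)
    (h : ∀ l ∈ P.weightLattice, ∫ v, f v * P.orbitSum l v ∂ν = 0)
    (ψ : C(UnitAddTorus b.support, ℂ)) :
    ∫ v, f v * ∑ u : P.linearWeylGroup, ψ (b.toTorus (u.1 v)) ∂ν = 0 := by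
  have hc (ψ : C(UnitAddTorus b.support, ℂ)) (u : P.linearWeylGroup) :
      Continuous fun v => ψ (b.toTorus (u.1 v)) :=
    ψ.continuous.comp (b.continuous_toTorus.comp
      (LinearMap.toContinuousLinearMap (u.1 : V →ₗ[ℝ] V)).continuous)
  have hi1 (ψ : C(UnitAddTorus b.support, ℂ)) (u : P.linearWeylGroup) :
      Integrable (fun v => f v * ψ (b.toTorus (u.1 v))) ν :=
    hf.mul_bdd (c := ‖ψ‖) (hc ψ u).aestronglyMeasurable
      (ae_of_all _ fun v => ψ.norm_coe_le_norm _)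
  have hi (ψ : C(UnitAddTorus b.support, ℂ)) :
      Integrable (fun v => f v * ∑ u : P.linearWeylGroup, ψ (b.toTorus (u.1 v))) ν := by
    simp_rw [Finset.mul_sum]
    exact integrable_finsetSum _ fun u _ => hi1 ψ u
  let Φ : C(UnitAddTorus b.support, ℂ) →ₗ[ℂ] ℂ :=
    { toFun := fun ψ => ∫ v, f v * ∑ u : P.linearWeylGroup, ψ (b.toTorus (u.1 v)) ∂ν
      map_add' := fun ψ₁ ψ₂ => by
        rw [← integral_add (hi ψ₁) (hi ψ₂)]
        simp [Finset.sum_add_distrib, mul_add]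
      map_smul' := fun c ψ => by
        rw [RingHom.id_apply, smul_eq_mul, ← integral_const_mul]
        refine integral_congr_ae (ae_of_all _ fun v => ?_)
        simp only [ContinuousMap.smul_apply, smul_eq_mul, ← Finset.mul_sum]
        ring }
  let Φ' : C(UnitAddTorus b.support, ℂ) →L[ℂ] ℂ :=
    Φ.mkContinuous (Fintype.card P.linearWeylGroup * ∫ v, ‖f v‖ ∂ν) fun ψ => by
      calc ‖Φ ψ‖ ≤ ∫ v, ‖f v‖ * (Fintype.card P.linearWeylGroup * ‖ψ‖) ∂ν := by
            refine norm_integral_le_of_norm_le (hf.norm.mul_const _) (ae_of_all _ fun v => ?_)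
            rw [norm_mul]
            refine mul_le_mul_of_nonneg_left ?_ (norm_nonneg _)
            refine (norm_sum_le_of_le _ fun u _ => ψ.norm_coe_le_norm _).trans_eq ?_
            simp
        _ = _ := by rw [integral_mul_const]; ring
  have hker : Submodule.span ℂ (Set.range (UnitAddTorus.mFourier (d := b.support)))
      ≤ LinearMap.ker Φ'.toLinearMap := by
    rw [Submodule.span_le]
    rintro _ ⟨n, rfl⟩
    obtain ⟨l, hl, hlv⟩ := b.exists_mFourier_toTorus_eq n
    change ∫ v, f v * ∑ u : P.linearWeylGroup, UnitAddTorus.mFourier n (b.toTorus (u.1 v)) ∂ν = 0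
    simp_rw [hlv]
    exact h l hl
  have htop := Submodule.topologicalClosure_minimal _ hker Φ'.isClosed_ker
  rw [UnitAddTorus.span_mFourier_closure_eq_top] at htop
  exact htop (Submodule.mem_top (x := ψ))

/-- Completeness of the orbit sums of plane waves on the alcove. -/
theorem IsEuclidean.ae_eq_zero_of_forall_integral_mul_orbitSum (hP : P.IsEuclidean)
    [Fintype P.linearWeylGroup] {f : V → ℂ} (hf : Integrable f (volume.restrict b.alcove))
    (h : ∀ l ∈ P.weightLattice, ∫ v in b.alcove, f v * P.orbitSum l v = 0) :
    f =ᵐ[volume.restrict b.alcove] 0 := by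
  classical
  have hAo : IsOpen b.alcove := b.isOpen_alcove
  have hcu (u : P.linearWeylGroup) : Continuous fun v => b.toTorus (u.1 v) :=
    b.continuous_toTorus.comp (LinearMap.toContinuousLinearMap (u.1 : V →ₗ[ℝ] V)).continuous
  -- the integrals over compact subsets of the alcove vanish
  have hK : ∀ K, IsCompact K → K ⊆ b.alcove → ∫ v in K, f v = 0 := by
    intro K hKc hKA
    have hF : IsClosed (b.toTorus '' K) := (hKc.image b.continuous_toTorus).isClosed
    -- Continuous functions bounded by `1` converging pointwise to the indicator of the image of `K`
    -- in the torus.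
    let ψ : ℕ → C(UnitAddTorus b.support, ℂ) := fun n =>
      ⟨fun x => ((hF.apprSeq n x : ℝ) : ℂ), by
        exact Complex.continuous_ofReal.comp (NNReal.continuous_coe.comp (hF.apprSeq n).continuous)⟩
    have hψ1 (n : ℕ) (x : UnitAddTorus b.support) : ‖ψ n x‖ ≤ 1 := by
      have h1 := HasOuterApproxClosed.apprSeq_apply_le_one hF n x
      change ‖((hF.apprSeq n x : ℝ) : ℂ)‖ ≤ 1
      rw [Complex.norm_real, Real.norm_eq_abs, NNReal.abs_eq]
      exact_mod_cast h1
    have hψl (x : UnitAddTorus b.support) :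
        Tendsto (fun n => ψ n x) atTop (𝓝 (if x ∈ b.toTorus '' K then 1 else 0)) := by
      have h1 := tendsto_pi_nhds.1 (HasOuterApproxClosed.tendsto_apprSeq hF) x
      have h2 := (Complex.continuous_ofReal.tendsto _).comp
        ((NNReal.continuous_coe.tendsto _).comp h1)
      convert! h2 using 2
      by_cases hx : x ∈ b.toTorus '' K
      · rw [if_pos hx, Set.indicator_of_mem hx]; simp
      · rw [if_neg hx, Set.indicator_of_notMem hx]; simp
    -- Freeness enters here: for `v` in the alcove only `u = 1` can bring `v` back into `K` modulo
    -- the coroot lattice, so symmetrizing the indicator returns the indicator of `K`.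
    have hsum {v : V} (hv : v ∈ b.alcove) :
        (∑ u : P.linearWeylGroup, if b.toTorus (u.1 v) ∈ b.toTorus '' K then (1 : ℂ) else 0)
          = K.indicator (fun _ => 1) v := by
      have hu : ∀ u : P.linearWeylGroup, b.toTorus (u.1 v) ∈ b.toTorus '' K → u = 1 ∧ v ∈ K := by
        rintro u ⟨k, hk, hkv⟩
        have h1 := b.sub_mem_corootLattice_of_toTorus_eq hkv
        have h2 : u.1 v + (k - u.1 v) = k := by abel
        obtain ⟨h3, h4⟩ := hP.eq_one_of_mem_alcove b u.2 h1 hv (by rw [h2]; exact hKA hk)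
        refine ⟨Subtype.ext h3, ?_⟩
        rw [h3, sub_eq_zero] at h4
        have h5 : k = v := h4
        exact h5 ▸ hk
      by_cases hvK : v ∈ K
      · rw [Set.indicator_of_mem hvK, Finset.sum_eq_single 1, if_pos ⟨v, hvK, rfl⟩]
        · intro u _ hne
          rw [if_neg fun hmem => hne (hu u hmem).1]
        · simp
      · rw [Set.indicator_of_notMem hvK]
        exact Finset.sum_eq_zero fun u _ => if_neg fun hmem => hvK (hu u hmem).2
    have hlim : Tendsto (fun n => ∫ v in b.alcove,
        f v * ∑ u : P.linearWeylGroup, ψ n (b.toTorus (u.1 v))) atTop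
        (𝓝 (∫ v in b.alcove, K.indicator f v)) := by
      refine tendsto_integral_of_dominated_convergence
        (fun v => ‖f v‖ * Fintype.card P.linearWeylGroup) (fun n => ?_) (hf.norm.mul_const _)
        (fun n => ae_of_all _ fun v => ?_) ?_
      · refine hf.aestronglyMeasurable.mul (Continuous.aestronglyMeasurable ?_)
        exact continuous_finsetSum _ fun u _ => (ψ n).continuous.comp (hcu u)
      · rw [norm_mul]
        refine mul_le_mul_of_nonneg_left ?_ (norm_nonneg _)
        refine (norm_sum_le_of_le _ fun u _ => hψ1 n _).trans_eq ?_
        simp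
      · filter_upwards [ae_restrict_mem hAo.measurableSet] with v hv
        have h1 : K.indicator f v = f v * ∑ u : P.linearWeylGroup,
            if b.toTorus (u.1 v) ∈ b.toTorus '' K then (1 : ℂ) else 0 := by
          rw [hsum hv]
          by_cases hvK : v ∈ K <;> simp [hvK]
        rw [h1]
        exact tendsto_const_nhds.mul (tendsto_finsetSum _ fun u _ => hψl _)
    simp_rw [b.integral_mul_sum_toTorus_eq_zero hf h] at hlim
    have h0 := tendsto_nhds_unique hlim tendsto_const_nhds
    rwa [setIntegral_indicator hKc.measurableSet, Set.inter_eq_right.2 hKA] at h0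
  refine ae_eq_zero_of_forall_setIntegral_isClosed_eq_zero hf fun s hs => ?_
  -- Exhausting the alcove by closed sets makes every piece `s ∩ F n` compact, since the alcove is
  -- bounded.
  obtain ⟨F, hFc, hFA, hFU, hFm⟩ := hAo.exists_iUnion_isClosed
  have hmono : Monotone fun n => s ∩ F n := fun n m hnm => Set.inter_subset_inter_right _ (hFm hnm)
  have hU : ⋃ n, s ∩ F n = s ∩ b.alcove := by rw [← Set.inter_iUnion, hFU]
  rw [Measure.restrict_restrict hs.measurableSet, ← hU]
  have hint : IntegrableOn f (⋃ n, s ∩ F n) := by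
    rw [hU]
    exact IntegrableOn.mono_set hf Set.inter_subset_right
  have hlim := tendsto_setIntegral_of_monotone (μ := volume) (f := f)
    (fun n => (hs.inter (hFc n)).measurableSet) hmono hint
  refine tendsto_nhds_unique hlim ?_
  have h0 (n : ℕ) : ∫ v in s ∩ F n, f v = 0 := by
    refine hK _ ?_ (Set.inter_subset_right.trans (hFA n))
    exact Metric.isCompact_of_isClosed_isBounded (hs.inter (hFc n))
      (b.isBounded_alcove.subset (Set.inter_subset_right.trans (hFA n)))
  simp_rw [h0]
  exact tendsto_const_nhds

end Torus

end RootPairing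

/-! ### Essentially self-adjoint operators -/

namespace LinearPMap

variable {H : Type*} [NormedAddCommGroup H] [InnerProductSpace ℂ H] [CompleteSpace H]
  {T : H →ₗ.[ℂ] H}

/-- A densely defined symmetric operator is closable. -/
theorem IsFormalAdjoint.isClosable (hd : Dense (T.domain : Set H)) (hs : T.IsFormalAdjoint T) :
    T.IsClosable :=
  (adjoint_isClosed hd).isClosable.leIsClosable (hs.le_adjoint hd)

/-- The closure of a densely defined symmetric operator is symmetric. -/
theorem IsFormalAdjoint.closure (hd : Dense (T.domain : Set H)) (hs : T.IsFormalAdjoint T) :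
    T.closure.IsFormalAdjoint T.closure := by
  have hg := (hs.isClosable hd).graph_closure_eq_closure_graph
  have hg' {p : H × H} (hp : p ∈ T.closure.graph) : p ∈ _root_.closure (T.graph : Set (H × H)) := by
    rw [← hg] at hp
    exact hp
  have h1 : ∀ p ∈ T.graph, ∀ q ∈ T.closure.graph, ⟪p.2, q.1⟫_ℂ = ⟪p.1, q.2⟫_ℂ := by
    intro p hp q hq
    have hcl : _root_.IsClosed {q : H × H | ⟪p.2, q.1⟫_ℂ = ⟪p.1, q.2⟫_ℂ} :=
      isClosed_eq (by fun_prop) (by fun_prop)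
    refine closure_minimal (fun q hq => ?_) hcl (hg' hq)
    obtain ⟨x, hx1, hx2⟩ := (mem_graph_iff T).1 hp
    obtain ⟨y, hy1, hy2⟩ := (mem_graph_iff T).1 hq
    change ⟪p.2, q.1⟫_ℂ = ⟪p.1, q.2⟫_ℂ
    rw [← hx1, ← hx2, ← hy1, ← hy2]
    exact hs x y
  have h2 : ∀ p ∈ T.closure.graph, ∀ q ∈ T.closure.graph, ⟪p.2, q.1⟫_ℂ = ⟪p.1, q.2⟫_ℂ := by
    intro p hp q hq
    have hcl : _root_.IsClosed {p : H × H | ⟪p.2, q.1⟫_ℂ = ⟪p.1, q.2⟫_ℂ} :=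
      isClosed_eq (by fun_prop) (by fun_prop)
    exact closure_minimal (fun p hp => h1 p hp q hq) hcl (hg' hp)
  exact fun x y => h2 _ (T.closure.mem_graph x) _ (T.closure.mem_graph y)

/-- A densely defined positive symmetric operator `T` such that the range of `1 + T` is dense is
essentially self-adjoint. -/
theorem isSelfAdjoint_closure_of_dense_range (hd : Dense (T.domain : Set H))
    (hs : T.IsFormalAdjoint T) (hpos : ∀ x : T.domain, 0 ≤ (⟪(x : H), T x⟫_ℂ).re)
    (hr : ∀ f : H, (∀ x : T.domain, ⟪f, (x : H) + T x⟫_ℂ = 0) → f = 0) :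
    IsSelfAdjoint T.closure := by
  have hc := hs.isClosable hd
  have hg := hc.graph_closure_eq_closure_graph
  have hs' := hs.closure hd
  have hle : T ≤ T.closure := T.le_closure
  have hd' : Dense (T.closure.domain : Set H) := hd.mono hle.1
  have hclosed : _root_.IsClosed (T.closure.graph : Set (H × H)) := hc.closure_isClosed
  have hpos' : ∀ p ∈ T.closure.graph, 0 ≤ (⟪p.1, p.2⟫_ℂ).re := by
    intro p hp
    have hcl : _root_.IsClosed {p : H × H | 0 ≤ (⟪p.1, p.2⟫_ℂ).re} :=
      isClosed_le continuous_const (Complex.continuous_re.comp (by fun_prop))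
    rw [← hg] at hp
    refine closure_minimal (fun q hq => ?_) hcl hp
    obtain ⟨x, hx1, hx2⟩ := (mem_graph_iff T).1 hq
    change 0 ≤ (⟪q.1, q.2⟫_ℂ).re
    rw [← hx1, ← hx2]
    exact hpos x
  -- The operator `1 + T.closure`, viewed on the complete graph. Positivity gives `‖x‖ ≤ ‖x + T x‖`,
  -- hence `‖T x‖ ≤ 2 ‖x + T x‖`; the range is therefore closed, and being dense it is everything.
  let S : H × H →L[ℂ] H := ContinuousLinearMap.fst ℂ H H + ContinuousLinearMap.snd ℂ H H
  let S' : T.closure.graph →L[ℂ] H := S.comp T.closure.graph.subtypeL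
  have hS' (p : T.closure.graph) : S' p = p.1.1 + p.1.2 := rfl
  have hanti : AntilipschitzWith 2 S' := by
    refine S'.antilipschitz_of_bound fun p => ?_
    have h1 : ‖p.1.1‖ ≤ ‖S' p‖ := by
      rcases eq_or_ne ‖p.1.1‖ 0 with h0 | h0
      · rw [h0]; exact norm_nonneg _
      have h2 : ‖p.1.1‖ * ‖p.1.1‖ ≤ ‖p.1.1‖ * ‖S' p‖ := by
        calc ‖p.1.1‖ * ‖p.1.1‖ ≤ (⟪p.1.1, p.1.1⟫_ℂ).re + (⟪p.1.1, p.1.2⟫_ℂ).re := by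
              have := hpos' p.1 p.2
              have h3 : (⟪p.1.1, p.1.1⟫_ℂ).re = ‖p.1.1‖ * ‖p.1.1‖ := by
                rw [← inner_self_eq_norm_mul_norm (𝕜 := ℂ)]; rfl
              linarith
          _ = (⟪p.1.1, S' p⟫_ℂ).re := by rw [hS', inner_add_right, Complex.add_re]
          _ ≤ ‖p.1.1‖ * ‖S' p‖ := (Complex.re_le_norm _).trans (norm_inner_le_norm _ _)
      exact le_of_mul_le_mul_left h2 (lt_of_le_of_ne (norm_nonneg _) h0.symm)
    have h2 : ‖p.1.2‖ ≤ 2 * ‖S' p‖ := by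
      have : p.1.2 = S' p - p.1.1 := by rw [hS']; abel
      rw [this]
      exact (norm_sub_le _ _).trans (by linarith)
    change max ‖p.1.1‖ ‖p.1.2‖ ≤ 2 * ‖S' p‖
    exact max_le (by linarith [norm_nonneg (S' p)]) h2
  have hcomplete : CompleteSpace T.closure.graph := hclosed.completeSpace_coe
  have hrange : _root_.IsClosed (S'.range : Set H) := by
    have := hanti.isClosed_range S'.uniformContinuous
    have h2 : (S'.range : Set H) = Set.range S' := by ext; simp
    rw [h2]
    exact this
  have htop : S'.range = ⊤ := by
    have : CompleteSpace S'.range := hrange.completeSpace_coe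
    rw [← Submodule.orthogonal_eq_bot_iff, Submodule.eq_bot_iff]
    intro f hf
    refine hr f fun x => ?_
    rw [Submodule.mem_orthogonal'] at hf
    exact hf _ ⟨⟨((x : H), T x), le_graph_of_le hle (T.mem_graph x)⟩, rfl⟩
  have hsurj (h : H) : ∃ x : T.closure.domain, (x : H) + T.closure x = h := by
    obtain ⟨p, hp⟩ : h ∈ S'.range := htop ▸ Submodule.mem_top
    obtain ⟨x, hx1, hx2⟩ := (mem_graph_iff T.closure).1 p.2
    exact ⟨x, by rw [hx1, hx2]; exact hp⟩
  rw [isSelfAdjoint_def]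
  refine le_antisymm ?_ (hs'.le_adjoint hd')
  refine le_of_le_graph fun q hq => ?_
  obtain ⟨g, hg1, hg2⟩ := (mem_graph_iff _).1 hq
  -- For `g` in the domain of the adjoint, solve `(1 + T.closure) x = (1 + T.closure†) g`. Then `g -
  -- x` is orthogonal to the full range of `1 + T.closure`, so `g = x`.
  obtain ⟨x, hx⟩ := hsurj ((g : H) + T.closure† g)
  have hgx : (g : H) = x := by
    obtain ⟨y, hy⟩ := hsurj ((g : H) - x)
    have h1 : ⟪(g : H) - x, (y : H) + T.closure y⟫_ℂ = 0 := by
      have h2 : ⟪T.closure† g, (y : H)⟫_ℂ = ⟪(g : H), T.closure y⟫_ℂ :=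
        adjoint_isFormalAdjoint hd' g y
      have h3 : ⟪T.closure x, (y : H)⟫_ℂ = ⟪(x : H), T.closure y⟫_ℂ := hs' x y
      have h4 : ⟪(g : H) + T.closure† g, (y : H)⟫_ℂ = ⟪(x : H) + T.closure x, (y : H)⟫_ℂ := by
        rw [hx]
      rw [inner_add_left, inner_add_left, h2, h3] at h4
      rw [inner_sub_left, inner_add_right, inner_add_right, h4, sub_self]
    rw [hy] at h1
    exact sub_eq_zero.1 (inner_self_eq_zero.1 h1)
  have h2 : T.closure† g = T.closure x := by
    rw [hgx] at hx
    exact (add_left_cancel hx).symm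
  exact (mem_graph_iff _).2 ⟨x, hgx.symm.trans hg1, h2.symm.trans hg2⟩

end LinearPMap

/-! ### Weak derivatives -/

section Sobolev

variable {V : Type*} [NormedAddCommGroup V] [InnerProductSpace ℝ V] [FiniteDimensional ℝ V]
  [MeasurableSpace V] [BorelSpace V] {A : Set V}

theorem L2On.inner_eq_integral (f g : L2On A) :
    ⟪f, g⟫_ℂ = ∫ v in A, g v * (starRingEnd ℂ) (f v) := by
  rw [L2.inner_def]
  rfl

/-- Expressing test integrals as inner products makes the weak derivative relation an intersection
of kernels of continuous functionals, hence a closed subspace. -/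
theorem exists_integral_smul_eq_inner {φ : V → ℝ} (hφ : Continuous φ) (hc : HasCompactSupport φ) :
    ∃ Φ : L2On A, ∀ f : L2On A, ∫ v in A, φ v • f v = ⟪Φ, f⟫_ℂ := by
  have hm : MemLp (fun v => ((φ v : ℝ) : ℂ)) 2 (volume.restrict A) :=
    Continuous.memLp_of_hasCompactSupport (by fun_prop) (hc.comp_left (g := Complex.ofReal) Complex.ofReal_zero)
  refine ⟨hm.toLp _, fun f => ?_⟩
  rw [L2On.inner_eq_integral]
  refine integral_congr_ae ?_
  filter_upwards [hm.coeFn_toLp] with v hv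
  rw [hv, Complex.conj_ofReal, Complex.real_smul, mul_comm]

/-- The graph of the weak derivative in direction `η` as a submodule. -/
theorem exists_submodule_hasWeakDeriv (A : Set V) (η : V) :
    ∃ S : Submodule ℂ (L2On A × L2On A), IsClosed (S : Set (L2On A × L2On A)) ∧
      ∀ f g, HasWeakDeriv A η f g ↔ (f, g) ∈ S := by
  let I := {φ : V → ℝ // ContDiff ℝ ∞ φ ∧ HasCompactSupport φ ∧ tsupport φ ⊆ A}
  choose Φ hΦ using fun φ : I => exists_integral_smul_eq_inner (A := A) φ.2.1.continuous φ.2.2.1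
  choose Ψ hΨ using fun φ : I => exists_integral_smul_eq_inner (A := A)
    (φ := fun v => fderiv ℝ φ.1 v η) ((φ.2.1.continuous_fderiv (by simp)).clm_apply continuous_const)
    (φ.2.2.1.fderiv_apply ℝ η)
  let L (φ : I) : L2On A × L2On A →L[ℂ] ℂ :=
    (innerSL ℂ (Ψ φ)).comp (ContinuousLinearMap.fst ℂ _ _)
      + (innerSL ℂ (Φ φ)).comp (ContinuousLinearMap.snd ℂ _ _)
  refine ⟨⨅ φ, LinearMap.ker (L φ).toLinearMap, ?_, fun f g => ?_⟩
  · rw [Submodule.coe_iInf]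
    exact isClosed_iInter fun φ => (L φ).isClosed_ker
  · have hL (φ : I) : L φ (f, g) = ⟪Ψ φ, f⟫_ℂ + ⟪Φ φ, g⟫_ℂ := rfl
    rw [Submodule.mem_iInf]
    constructor
    · intro h φ
      have := h φ.1 φ.2.1 φ.2.2.1 φ.2.2.2
      rw [hΦ φ g, hΨ φ f] at this
      change L φ (f, g) = 0
      rw [hL, this, neg_add_cancel]
    · intro h φ h1 h2 h3
      have h4 : L ⟨φ, h1, h2, h3⟩ (f, g) = 0 := h ⟨φ, h1, h2, h3⟩
      have h5 := hΦ ⟨φ, h1, h2, h3⟩ g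
      have h6 := hΨ ⟨φ, h1, h2, h3⟩ f
      dsimp only at h5 h6
      rw [h5, h6]
      rw [hL] at h4
      exact eq_neg_of_add_eq_zero_left h4

theorem HasWeakDeriv.sub {η : V} {f₁ f₂ g₁ g₂ : L2On A} (h₁ : HasWeakDeriv A η f₁ g₁)
    (h₂ : HasWeakDeriv A η f₂ g₂) : HasWeakDeriv A η (f₁ - f₂) (g₁ - g₂) := by
  obtain ⟨S, -, hS⟩ := exists_submodule_hasWeakDeriv A η
  rw [hS] at *
  exact S.sub_mem h₁ h₂

theorem HasWeakDeriv.add {η : V} {f₁ f₂ g₁ g₂ : L2On A} (h₁ : HasWeakDeriv A η f₁ g₁)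
    (h₂ : HasWeakDeriv A η f₂ g₂) : HasWeakDeriv A η (f₁ + f₂) (g₁ + g₂) := by
  obtain ⟨S, -, hS⟩ := exists_submodule_hasWeakDeriv A η
  rw [hS] at *
  exact S.add_mem h₁ h₂

theorem HasWeakDeriv.smul {η : V} {f g : L2On A} (c : ℂ) (h : HasWeakDeriv A η f g) :
    HasWeakDeriv A η (c • f) (c • g) := by
  obtain ⟨S, -, hS⟩ := exists_submodule_hasWeakDeriv A η
  rw [hS] at *
  exact S.smul_mem c h

theorem HasWeakDeriv.zero (η : V) : HasWeakDeriv A η (0 : L2On A) 0 := by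
  obtain ⟨S, -, hS⟩ := exists_submodule_hasWeakDeriv A η
  rw [hS] at *
  exact S.zero_mem

theorem isClosed_hasWeakDeriv (A : Set V) (η : V) :
    IsClosed {p : L2On A × L2On A | HasWeakDeriv A η p.1 p.2} := by
  obtain ⟨S, hc, hS⟩ := exists_submodule_hasWeakDeriv A η
  convert! hc using 1
  ext p
  exact hS p.1 p.2

theorem HasWeakDeriv.of_tendsto {η : V} {f g : L2On A} {u w : ℕ → L2On A}
    (h : ∀ n, HasWeakDeriv A η (u n) (w n)) (hu : Tendsto u atTop (𝓝 f))
    (hw : Tendsto w atTop (𝓝 g)) : HasWeakDeriv A η f g :=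
  (isClosed_hasWeakDeriv A η).mem_of_tendsto (hu.prodMk_nhds hw) (Eventually.of_forall h)

theorem HasWeakDeriv.unique (hA : IsOpen A) {η : V} {f g₁ g₂ : L2On A}
    (h₁ : HasWeakDeriv A η f g₁) (h₂ : HasWeakDeriv A η f g₂) : g₁ = g₂ := by
  have h := h₁.sub h₂
  rw [sub_self] at h
  rw [← sub_eq_zero]
  set g := g₁ - g₂
  have hloc : LocallyIntegrableOn g A := by
    have h1 : LocallyIntegrable g (volume.restrict A) :=
      (Lp.memLp g).locallyIntegrable (by norm_num)
    rw [locallyIntegrableOn_iff hA.isLocallyClosed]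
    intro k hk hkc
    have := h1.integrableOn_isCompact hkc
    rwa [IntegrableOn, Measure.restrict_restrict hkc.measurableSet, Set.inter_eq_left.2 hk] at this
  have hz := hA.ae_eq_zero_of_integral_contDiff_smul_eq_zero hloc fun φ hφ hφc hφs => by
    have h1 := h φ hφ hφc hφs
    have h2 : ∫ v in A, (fderiv ℝ φ v η) • (0 : L2On A) v = 0 := by
      refine integral_eq_zero_of_ae ?_
      filter_upwards [Lp.coeFn_zero ℂ 2 ((volume : Measure V).restrict A)] with v hv
      rw [hv]
      simp
    rw [h2] at h1
    rw [← setIntegral_eq_integral_of_forall_compl_eq_zero (s := A)]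
    · exact neg_eq_zero.1 h1.symm
    · intro v hv
      have : φ v = 0 := by
        by_contra h0
        exact hv (hφs (subset_tsupport _ h0))
      rw [this, zero_smul]
  refine Lp.ext ?_
  filter_upwards [(ae_restrict_iff' hA.measurableSet).2 hz,
    Lp.coeFn_zero ℂ 2 ((volume : Measure V).restrict A)] with v h1 h2
  rw [h1, h2]
  rfl

theorem HasWeakDeriv.weakDeriv_eq (hA : IsOpen A) {η : V} {f g : L2On A}
    (h : HasWeakDeriv A η f g) : weakDeriv A η f = g := by
  have hex : ∃ g : L2On A, HasWeakDeriv A η f g := ⟨g, h⟩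
  rw [weakDeriv, dif_pos hex]
  exact hex.choose_spec.unique hA h

theorem hasWeakDeriv_weakDeriv {f : L2On A} (hf : f ∈ sobolevW12 A) (η : V) :
    HasWeakDeriv A η f (weakDeriv A η f) := by
  rw [weakDeriv, dif_pos (hf η)]
  exact (hf η).choose_spec

/-- Weak derivatives in the directions of a basis suffice. -/
theorem mem_sobolevW12_of_orthonormalBasis {κ : Type*} [Fintype κ] (η : OrthonormalBasis κ ℝ V)
    {f : L2On A} {F : κ → L2On A} (hF : ∀ j, HasWeakDeriv A (η j) f (F j)) : f ∈ sobolevW12 A := by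
  intro x
  refine ⟨∑ j, ((⟪η j, x⟫_ℝ : ℝ) : ℂ) • F j, fun φ h1 h2 h3 => ?_⟩
  obtain ⟨Φ, hΦ⟩ := exists_integral_smul_eq_inner (A := A) h1.continuous h2
  choose Ψ hΨ using fun y => exists_integral_smul_eq_inner (A := A)
    (φ := fun v => fderiv ℝ φ v y) ((h1.continuous_fderiv (by simp)).clm_apply continuous_const)
    (h2.fderiv_apply ℝ y)
  have hj (j : κ) : ⟪Ψ (η j), f⟫_ℂ = -⟪Φ, F j⟫_ℂ := by
    rw [← hΨ, ← hΦ]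
    exact hF j φ h1 h2 h3
  rw [hΦ, inner_sum, ← Finset.sum_neg_distrib]
  have hsum : ∫ v in A, (fderiv ℝ φ v x) • f v
      = ∫ v in A, ∑ j, ((⟪η j, x⟫_ℝ : ℝ) : ℂ) * ((fderiv ℝ φ v (η j)) • f v) := by
    refine integral_congr_ae (ae_of_all _ fun v => ?_)
    dsimp only
    conv_lhs => rw [← η.sum_repr' x]
    rw [map_sum, Finset.sum_smul]
    refine Finset.sum_congr rfl fun j _ => ?_
    rw [map_smul, smul_eq_mul, mul_smul, Complex.real_smul]
  rw [hsum, integral_finsetSum]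
  · refine Finset.sum_congr rfl fun j _ => ?_
    rw [integral_const_mul, hΨ, hj, inner_smul_right, mul_neg]
  · intro j _
    refine Integrable.const_mul ?_ _
    simp_rw [Complex.real_smul]
    refine L2On.integrable_fun_mul f (Continuous.memLp_of_hasCompactSupport ?_ ?_)
    · have := h1.continuous_fderiv (by simp)
      fun_prop
    · exact (h2.fderiv_apply ℝ (η j)).comp_left (g := Complex.ofReal) Complex.ofReal_zero

/-- Classical derivatives are weak derivatives. -/
theorem HasWeakDeriv.of_contDiff {g : V → ℂ} (hg : ContDiff ℝ ∞ g) (η : V) {f f' : L2On A}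
    (hf : f =ᵐ[volume.restrict A] g)
    (hf' : f' =ᵐ[volume.restrict A] fun v => fderiv ℝ g v η) : HasWeakDeriv A η f f' := by
  intro φ h1 h2 h3
  have hφ0 {v : V} (hv : v ∉ A) : φ v = 0 := by
    by_contra h0
    exact hv (h3 (subset_tsupport _ h0))
  have hdφ0 {v : V} (hv : v ∉ A) : fderiv ℝ φ v η = 0 := by
    by_contra h0
    exact hv (h3 (tsupport_fderiv_apply_subset ℝ η (subset_tsupport _ h0)))
  -- The test function vanishes off `A`, so both integrals extend to `V`, where integration by parts
  -- has no boundary.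
  have e1 : ∫ v in A, (fderiv ℝ φ v η) • f v = ∫ v, ((fderiv ℝ φ v η : ℝ) : ℂ) * g v := by
    refine Eq.trans (integral_congr_ae ?_) (setIntegral_eq_integral_of_forall_compl_eq_zero (s := A)
      fun v hv => by rw [hdφ0 hv, Complex.ofReal_zero, zero_mul])
    filter_upwards [hf] with v hv
    rw [hv, Complex.real_smul]
  have e2 : ∫ v in A, φ v • f' v = ∫ v, (φ v : ℂ) * fderiv ℝ g v η := by
    refine Eq.trans (integral_congr_ae ?_) (setIntegral_eq_integral_of_forall_compl_eq_zero (s := A)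
      fun v hv => by rw [hφ0 hv, Complex.ofReal_zero, zero_mul])
    filter_upwards [hf'] with v hv
    rw [hv, Complex.real_smul]
  rw [e1, e2]
  have hφC : ContDiff ℝ ∞ fun v => ((φ v : ℝ) : ℂ) := Complex.ofRealCLM.contDiff.comp h1
  have hd (v : V) : fderiv ℝ (fun v => ((φ v : ℝ) : ℂ)) v η = ((fderiv ℝ φ v η : ℝ) : ℂ) := by
    have := (Complex.ofRealCLM.hasFDerivAt.comp v (h1.differentiable (by simp) v).hasFDerivAt).fderiv
    exact congrArg (fun T : V →L[ℝ] ℂ => T η) this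
  have hcs : HasCompactSupport fun v => ((φ v : ℝ) : ℂ) := h2.comp_left (g := Complex.ofReal) Complex.ofReal_zero
  have hc1 : Continuous fun v => fderiv ℝ g v η :=
    (hg.continuous_fderiv (by simp)).clm_apply continuous_const
  have hc2 : Continuous fun v => fderiv ℝ (fun v => ((φ v : ℝ) : ℂ)) v η :=
    (hφC.continuous_fderiv (by simp)).clm_apply continuous_const
  have key := integral_mul_fderiv_eq_neg_fderiv_mul_of_integrable (μ := (volume : Measure V))
    (f := fun v => ((φ v : ℝ) : ℂ)) (g := g) (v := η)
    ((hc2.mul hg.continuous).integrable_of_hasCompactSupport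
      (HasCompactSupport.mul_right (hcs.fderiv_apply ℝ η)))
    ((hφC.continuous.mul hc1).integrable_of_hasCompactSupport hcs.mul_right)
    ((hφC.continuous.mul hg.continuous).integrable_of_hasCompactSupport hcs.mul_right)
    (fun v _ => hφC.differentiable (by simp) v) (fun v _ => hg.differentiable (by simp) v)
  simp_rw [hd] at key
  rw [key, neg_neg]

end Sobolev

/-! ### Green's identity in `L²` and its stability under limits -/

section GreenIdentity

variable {V : Type*} [NormedAddCommGroup V] [InnerProductSpace ℝ V] [FiniteDimensional ℝ V]
  [MeasurableSpace V] [BorelSpace V] {A : Set V} {κ : Type*} [Fintype κ]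
  {η : OrthonormalBasis κ ℝ V}

/-- The function `p.1` has the weak gradient `X`, and Green's identity without boundary term holds
with `p.2` in place of `-Δ p.1`. -/
structure GreenIdentity (A : Set V) (η : OrthonormalBasis κ ℝ V) (p : L2On A × L2On A)
    (X : κ → L2On A) : Prop where
  hasWeakDeriv : ∀ j, HasWeakDeriv A (η j) p.1 (X j)
  sum_inner : ∀ (f : L2On A) (F : κ → L2On A), (∀ j, HasWeakDeriv A (η j) f (F j)) →
    ∑ j, ⟪X j, F j⟫_ℂ = ⟪p.2, f⟫_ℂ

namespace GreenIdentity

variable {p q : L2On A × L2On A} {X Y : κ → L2On A}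

theorem sum_norm_sq (h : GreenIdentity A η p X) :
    ((∑ j, ‖X j‖ ^ 2 : ℝ) : ℂ) = ⟪p.2, p.1⟫_ℂ := by
  rw [← h.sum_inner _ _ h.hasWeakDeriv]
  push_cast
  exact Finset.sum_congr rfl fun j _ => (inner_self_eq_norm_sq_to_K (𝕜 := ℂ) (X j)).symm

theorem sub (h : GreenIdentity A η p X) (h' : GreenIdentity A η q Y) :
    GreenIdentity A η (p - q) (X - Y) where
  hasWeakDeriv j := (h.hasWeakDeriv j).sub (h'.hasWeakDeriv j)
  sum_inner f F hF := by
    simp only [Pi.sub_apply, inner_sub_left, Finset.sum_sub_distrib, Prod.snd_sub]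
    rw [h.sum_inner f F hF, h'.sum_inner f F hF]

theorem norm_sq_le (h : GreenIdentity A η p X) (j : κ) : ‖X j‖ ^ 2 ≤ ‖⟪p.2, p.1⟫_ℂ‖ := by
  rw [← h.sum_norm_sq, Complex.norm_real, Real.norm_eq_abs,
    abs_of_nonneg (Finset.sum_nonneg fun _ _ => by positivity)]
  exact Finset.single_le_sum (f := fun j => ‖X j‖ ^ 2) (fun _ _ => by positivity)
    (Finset.mem_univ j)

/-- Gradients of a sequence that is Cauchy for the form form a Cauchy sequence. -/
theorem cauchySeq {p : ℕ → L2On A × L2On A} {X : ℕ → κ → L2On A}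
    (h : ∀ n, GreenIdentity A η (p n) (X n))
    (hp : Tendsto (fun k : ℕ × ℕ => ⟪(p k.1 - p k.2).2, (p k.1 - p k.2).1⟫_ℂ) atTop (𝓝 0))
    (j : κ) : CauchySeq fun n => X n j := by
  rw [cauchySeq_iff_tendsto_dist_atTop_0]
  have h1 : Tendsto (fun k : ℕ × ℕ => ‖X k.1 j - X k.2 j‖ ^ 2) atTop (𝓝 0) :=
    squeeze_zero (fun _ => by positivity) (fun k => ((h k.1).sub (h k.2)).norm_sq_le j)
      (by simpa using hp.norm)
  have h2 := (Real.continuous_sqrt.tendsto _).comp h1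
  rw [Real.sqrt_zero] at h2
  refine h2.congr fun k => ?_
  rw [Function.comp_apply, Real.sqrt_sq (norm_nonneg _), dist_eq_norm]

/-- Convergence in the graph norm makes the sequence Cauchy for the form, so the gradients converge,
and both clauses are closed conditions. This carries Green's identity from the smooth functions to
the domain of the closure. -/
theorem exists_of_tendsto {p : ℕ → L2On A × L2On A} {X : ℕ → κ → L2On A}
    (h : ∀ n, GreenIdentity A η (p n) (X n)) {q : L2On A × L2On A}
    (hq : Tendsto p atTop (𝓝 q)) : ∃ Y, GreenIdentity A η q Y := by
  have hp : Tendsto (fun k : ℕ × ℕ => ⟪(p k.1 - p k.2).2, (p k.1 - p k.2).1⟫_ℂ) atTop (𝓝 0) := by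
    have h1 : Tendsto (fun k : ℕ × ℕ => p k.1 - p k.2) atTop (𝓝 0) := by
      have := (hq.comp tendsto_fst).sub (hq.comp (tendsto_snd (f := atTop (α := ℕ))))
      rw [sub_self, prod_atTop_atTop_eq] at this
      exact this
    have h2 : Continuous fun r : L2On A × L2On A => ⟪r.2, r.1⟫_ℂ := by fun_prop
    have h3 := (h2.tendsto 0).comp h1
    rw [Prod.snd_zero, inner_zero_left] at h3
    exact h3
  choose Y hY using fun j => cauchySeq_tendsto_of_complete (cauchySeq h hp j)
  refine ⟨Y, fun j => .of_tendsto (fun n => (h n).hasWeakDeriv j)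
    ((continuous_fst.tendsto _).comp hq) (hY j), fun f F hF => ?_⟩
  have h1 : Tendsto (fun n => ∑ j, ⟪X n j, F j⟫_ℂ) atTop (𝓝 (∑ j, ⟪Y j, F j⟫_ℂ)) :=
    tendsto_finsetSum _ fun j _ => (hY j).inner tendsto_const_nhds
  have h2 : Tendsto (fun n => ⟪(p n).2, f⟫_ℂ) atTop (𝓝 ⟪q.2, f⟫_ℂ) :=
    ((continuous_snd.tendsto _).comp hq).inner tendsto_const_nhds
  exact tendsto_nhds_unique (h1.congr fun n => (h n).sum_inner f F hF) h2

end GreenIdentity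

omit [FiniteDimensional ℝ V] [MeasurableSpace V] [BorelSpace V] in
theorem fderiv_conj_apply {g : V → ℂ} (hg : ContDiff ℝ ∞ g) (v x : V) :
    fderiv ℝ (fun v => (starRingEnd ℂ) (g v)) v x = (starRingEnd ℂ) (fderiv ℝ g v x) := by
  have := (Complex.conjCLE.toContinuousLinearMap.hasFDerivAt.comp v
    (hg.differentiable (by simp) v).hasFDerivAt).fderiv
  exact congrArg (fun T : V →L[ℝ] ℂ => T x) this

omit [FiniteDimensional ℝ V] [MeasurableSpace V] [BorelSpace V] in
theorem contDiff_conj {g : V → ℂ} (hg : ContDiff ℝ ∞ g) :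
    ContDiff ℝ ∞ fun v => (starRingEnd ℂ) (g v) :=
  Complex.conjCLE.contDiff.comp hg

omit [MeasurableSpace V] [BorelSpace V] in
theorem laplacian_conj {g : V → ℂ} (hg : ContDiff ℝ ∞ g) (v : V) :
    Laplacian.laplacian (fun v => (starRingEnd ℂ) (g v)) v
      = (starRingEnd ℂ) (Laplacian.laplacian g v) := by
  have hd (x : V) : ContDiff ℝ ∞ fun v => fderiv ℝ g v x :=
    (hg.fderiv_right (m := ∞) le_rfl).clm_apply contDiff_const
  rw [laplacian_eq_sum_fderiv_fderiv (stdOrthonormalBasis ℝ V) hg,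
    laplacian_eq_sum_fderiv_fderiv (stdOrthonormalBasis ℝ V) (contDiff_conj hg), map_sum]
  refine Finset.sum_congr rfl fun j _ => ?_
  simp_rw [fderiv_conj_apply hg]
  exact fderiv_conj_apply (hd _) _ _

end GreenIdentity

/-! ### Self-adjointness and the form domain of the free Laplacian -/

section FreeLaplacian

variable {V : Type*} [NormedAddCommGroup V] [InnerProductSpace ℝ V] [FiniteDimensional ℝ V]
  [MeasurableSpace V] [BorelSpace V] {ι : Type*} [Finite ι] {P : RootPairing ι ℝ V V}
  [P.IsRootSystem] {b : P.Base} {κ : Type*} [Fintype κ]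

namespace RootPairing.IsEuclidean

variable (hP : P.IsEuclidean)
include hP

/-- Green's formula is applied to the conjugate of `g`, again smooth and invariant, because the
inner product conjugates its first argument. Invariance supplies the Neumann condition. -/
theorem exists_greenIdentity_of_mem_negLaplacianGraph (η : OrthonormalBasis κ ℝ V)
    {p : L2On b.alcove × L2On b.alcove}
    (hp : p ∈ negLaplacianGraph P.affineWeylGroup b.alcove) :
    ∃ X, GreenIdentity b.alcove η p X := by
  obtain ⟨g, hg, hgW, h1, h2⟩ := hp
  have hb := b.isBounded_alcove
  have hAm := b.isOpen_alcove.measurableSet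
  have hfin : IsFiniteMeasure ((volume : Measure V).restrict b.alcove) :=
    isFiniteMeasure_restrict.2 hb.measure_lt_top.ne
  have hm (x : V) : MemLp (fun v => fderiv ℝ g v x) 2 (volume.restrict b.alcove) :=
    memLp_restrict_of_continuous hAm hb
      ((hg.continuous_fderiv (by simp)).clm_apply continuous_const)
  refine ⟨fun j => (hm (η j)).toLp _,
    fun j => .of_contDiff hg (η j) h1 (hm (η j)).coeFn_toLp, fun f F hF => ?_⟩
  have hgreen := sum_integral_fderiv_mul_eq_neg_integral_laplacian_mul (fun i => P.ne_zero i) b.alcove_eq hb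
    (contDiff_conj hg) (fun i v hv => hP.fderiv_root_eq_zero b
      ((contDiff_conj hg).differentiable (by simp)) (fun w hw v => by rw [hgW w hw]) hv) η hF
  have e1 (j : κ) : ⟪(hm (η j)).toLp _, F j⟫_ℂ
      = ∫ v in b.alcove, fderiv ℝ (fun v => (starRingEnd ℂ) (g v)) v (η j) * F j v := by
    rw [L2On.inner_eq_integral]
    refine integral_congr_ae ?_
    filter_upwards [(hm (η j)).coeFn_toLp] with v hv
    rw [hv, fderiv_conj_apply hg, mul_comm]
  have e2 : ⟪p.2, f⟫_ℂ = -∫ v in b.alcove,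
      Laplacian.laplacian (fun v => (starRingEnd ℂ) (g v)) v * f v := by
    rw [L2On.inner_eq_integral, ← integral_neg]
    refine integral_congr_ae ?_
    filter_upwards [h2] with v hv
    rw [hv, laplacian_conj hg, map_neg]
    ring
  rw [Finset.sum_congr rfl fun j _ => e1 j, hgreen, e2]

/-- The orbit sums are eigenfunctions with eigenvalue `(2π‖l‖)²`. Stated for eigenfunctions,
completeness yields both the density of the domain and that of the range of `1 - Δ`. -/
theorem eq_zero_of_forall_eigenfunction [P.IsCrystallographic] [P.IsReduced] {f : L2On b.alcove}
    (h : ∀ (x : L2On b.alcove) (c : ℝ), 0 ≤ c →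
      (x, (c : ℂ) • x) ∈ negLaplacianGraph P.affineWeylGroup b.alcove → ⟪f, x⟫_ℂ = 0) : f = 0 := by
  have := P.finite_linearWeylGroup
  have := Fintype.ofFinite P.linearWeylGroup
  have hb := b.isBounded_alcove
  have hAm := b.isOpen_alcove.measurableSet
  have hfin : IsFiniteMeasure ((volume : Measure V).restrict b.alcove) :=
    isFiniteMeasure_restrict.2 hb.measure_lt_top.ne
  have hm (l : V) : MemLp (P.orbitSum l) 2 (volume.restrict b.alcove) :=
    memLp_restrict_of_continuous hAm hb (contDiff_orbitSum l).continuous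
  have hfi : Integrable (fun v => (starRingEnd ℂ) (f v)) (volume.restrict b.alcove) :=
    Complex.conjCLE.toContinuousLinearMap.integrable_comp
      ((Lp.memLp f).integrable (by norm_num))
  have h0 := hP.ae_eq_zero_of_forall_integral_mul_orbitSum b hfi fun l hl => by
    have h1 := h ((hm l).toLp _) ((2 * Real.pi * ‖l‖) ^ 2) (by positivity)
      ⟨P.orbitSum l, contDiff_orbitSum l, fun w hw v => hP.orbitSum_apply_affineWeylGroup hl hw v,
        (hm l).coeFn_toLp, by
          filter_upwards [(hm l).coeFn_toLp, Lp.coeFn_smul (((2 * Real.pi * ‖l‖) ^ 2 : ℝ) : ℂ)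
            ((hm l).toLp _)] with v h1 h2
          rw [h2, Pi.smul_apply, h1, hP.laplacian_orbitSum, smul_eq_mul]
          ring⟩
    rw [L2On.inner_eq_integral] at h1
    rw [← h1]
    refine integral_congr_ae ?_
    filter_upwards [(hm l).coeFn_toLp] with v hv
    rw [hv, mul_comm]
  refine Lp.ext ?_
  filter_upwards [h0, Lp.coeFn_zero ℂ 2 ((volume : Measure V).restrict b.alcove)] with v h1 h2
  rw [h2]
  simpa using h1

variable [P.IsCrystallographic] [P.IsReduced]

theorem dense_domain_negLaplacian :
    Dense ((negLaplacian P.affineWeylGroup b.alcove).domain : Set (L2On b.alcove)) := by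
  rw [Submodule.dense_iff_topologicalClosure_eq_top, Submodule.topologicalClosure_eq_top_iff,
    Submodule.eq_bot_iff]
  intro f hf
  refine hP.eq_zero_of_forall_eigenfunction fun x c _ hx => ?_
  rw [← negLaplacian_graph _ b.isOpen_alcove] at hx
  rw [Submodule.mem_orthogonal'] at hf
  exact hf x (LinearPMap.mem_domain_of_mem_graph hx)

/-- On an eigenfunction `1 - Δ` is multiplication by `1 + c`, nonzero since `c ≥ 0`. -/
theorem eq_zero_of_forall_inner_add_negLaplacian {f : L2On b.alcove}
    (hf : ∀ x : (negLaplacian P.affineWeylGroup b.alcove).domain,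
      ⟪f, (x : L2On b.alcove) + negLaplacian P.affineWeylGroup b.alcove x⟫_ℂ = 0) : f = 0 := by
  refine hP.eq_zero_of_forall_eigenfunction fun x c hc hx => ?_
  rw [← negLaplacian_graph _ b.isOpen_alcove] at hx
  obtain ⟨y, hy1, hy2⟩ := (LinearPMap.mem_graph_iff _).1 hx
  have h1 := hf y
  dsimp only at hy1 hy2
  rw [hy1, hy2, inner_add_right, inner_smul_right, ← one_add_mul] at h1
  refine (mul_eq_zero.1 h1).resolve_left ?_
  norm_cast
  positivity

omit [P.IsCrystallographic] [P.IsReduced] in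
theorem negLaplacian_greenIdentity (η : OrthonormalBasis κ ℝ V)
    (x : (negLaplacian P.affineWeylGroup b.alcove).domain) :
    ∃ X, GreenIdentity b.alcove η ((x : L2On b.alcove), negLaplacian P.affineWeylGroup b.alcove x)
      X :=
  hP.exists_greenIdentity_of_mem_negLaplacianGraph η <| by
    rw [← negLaplacian_graph _ b.isOpen_alcove]
    exact LinearPMap.mem_graph _ x

omit [P.IsCrystallographic] [P.IsReduced] in
theorem isFormalAdjoint_negLaplacian :
    (negLaplacian P.affineWeylGroup b.alcove).IsFormalAdjoint
      (negLaplacian P.affineWeylGroup b.alcove) := by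
  intro x y
  obtain ⟨X, hX⟩ := hP.negLaplacian_greenIdentity (stdOrthonormalBasis ℝ V) x
  obtain ⟨Y, hY⟩ := hP.negLaplacian_greenIdentity (stdOrthonormalBasis ℝ V) y
  have h1 := hX.sum_inner _ _ hY.hasWeakDeriv
  have h2 := hY.sum_inner _ _ hX.hasWeakDeriv
  dsimp only at h1 h2
  rw [← h1, ← inner_conj_symm, ← h2, map_sum]
  exact Finset.sum_congr rfl fun j _ => (inner_conj_symm _ _).symm

theorem isSelfAdjoint_freeLaplacian : IsSelfAdjoint (freeLaplacian b) := by
  refine LinearPMap.isSelfAdjoint_closure_of_dense_range hP.dense_domain_negLaplacian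
    hP.isFormalAdjoint_negLaplacian (fun x => ?_)
    fun f => hP.eq_zero_of_forall_inner_add_negLaplacian
  obtain ⟨X, hX⟩ := hP.negLaplacian_greenIdentity (stdOrthonormalBasis ℝ V) x
  have h1 := hX.sum_norm_sq
  dsimp only at h1
  rw [← inner_conj_symm, ← h1, Complex.conj_ofReal, Complex.ofReal_re]
  positivity

theorem freeLaplacian_greenIdentity (η : OrthonormalBasis κ ℝ V) (x : (freeLaplacian b).domain) :
    ∃ X, GreenIdentity b.alcove η ((x : L2On b.alcove), freeLaplacian b x) X := by
  have hc := hP.isFormalAdjoint_negLaplacian.isClosable (hP.dense_domain_negLaplacian (b := b))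
  have hx : ((x : L2On b.alcove), freeLaplacian b x)
      ∈ (negLaplacian P.affineWeylGroup b.alcove).closure.graph := (freeLaplacian b).mem_graph x
  rw [← hc.graph_closure_eq_closure_graph] at hx
  obtain ⟨p, hp, hlim⟩ := mem_closure_iff_seq_limit.1 hx
  choose X hX using fun n => hP.exists_greenIdentity_of_mem_negLaplacianGraph η (p := p n) <| by
    rw [← negLaplacian_graph _ b.isOpen_alcove]
    exact hp n
  exact GreenIdentity.exists_of_tendsto hX hlim

theorem freeLaplacian_greenIdentity_weakDeriv (η : OrthonormalBasis κ ℝ V)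
    (x : (freeLaplacian b).domain) :
    GreenIdentity b.alcove η ((x : L2On b.alcove), freeLaplacian b x)
      fun j => weakDeriv b.alcove (η j) x := by
  obtain ⟨X, hX⟩ := hP.freeLaplacian_greenIdentity η x
  have : (fun j => weakDeriv b.alcove (η j) (x : L2On b.alcove)) = X :=
    funext fun j => (hX.hasWeakDeriv j).weakDeriv_eq b.isOpen_alcove
  rwa [this]

/-- By Green's identity the form at `u` is `∑ ‖∂_j u‖²`, so Cauchy for the form means that the
gradients are Cauchy. Closedness of the weak derivatives identifies their limit as the gradient of
`f`. -/
theorem formTendsto_iff (η : OrthonormalBasis κ ℝ V) {u : ℕ → (freeLaplacian b).domain}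
    {f : L2On b.alcove} :
    FormTendsto (freeLaplacian b) u f ↔ f ∈ sobolevW12 b.alcove ∧
      Tendsto (fun n => (u n : L2On b.alcove)) atTop (𝓝 f) ∧
      ∀ j, Tendsto (fun n => weakDeriv b.alcove (η j) (u n)) atTop
        (𝓝 (weakDeriv b.alcove (η j) f)) := by
  have hG := hP.freeLaplacian_greenIdentity_weakDeriv (b := b) η
  have hsub (k : ℕ × ℕ) : ((u k.1 : L2On b.alcove), freeLaplacian b (u k.1))
      - ((u k.2 : L2On b.alcove), freeLaplacian b (u k.2))
      = (((u k.1 - u k.2 : (freeLaplacian b).domain) : L2On b.alcove),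
        freeLaplacian b (u k.1 - u k.2)) := by
    rw [LinearPMap.map_sub]; rfl
  constructor
  · rintro ⟨h1, h2⟩
    have h3 : Tendsto (fun k : ℕ × ℕ =>
        ⟪freeLaplacian b (u k.1 - u k.2),
          ((u k.1 - u k.2 : (freeLaplacian b).domain) : L2On b.alcove)⟫_ℂ) atTop (𝓝 0) := by
      have h4 := (Complex.continuous_conj.tendsto _).comp h2
      rw [map_zero] at h4
      exact h4.congr fun k => inner_conj_symm _ _
    have hc := GreenIdentity.cauchySeq (fun n => hG (u n)) (h3.congr fun k => by rw [hsub k])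
    choose F hF using fun j => cauchySeq_tendsto_of_complete (hc j)
    have hfF (j : κ) : HasWeakDeriv b.alcove (η j) f (F j) :=
      .of_tendsto (fun n => (hG (u n)).hasWeakDeriv j) h1 (hF j)
    refine ⟨mem_sobolevW12_of_orthonormalBasis η hfF, h1, fun j => ?_⟩
    rw [(hfF j).weakDeriv_eq b.isOpen_alcove]
    exact hF j
  · rintro ⟨-, h1, h2⟩
    refine ⟨h1, ?_⟩
    have h3 : Tendsto (fun k : ℕ × ℕ => ((∑ j, ‖weakDeriv b.alcove (η j) (u k.1 : L2On b.alcove)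
        - weakDeriv b.alcove (η j) (u k.2 : L2On b.alcove)‖ ^ 2 : ℝ) : ℂ)) atTop (𝓝 0) := by
      rw [← Complex.ofReal_zero]
      refine (Complex.continuous_ofReal.tendsto _).comp ?_
      rw [← Finset.sum_const_zero (s := Finset.univ (α := κ))]
      refine tendsto_finsetSum _ fun j _ => ?_
      have h4 := ((h2 j).comp tendsto_fst).sub ((h2 j).comp (tendsto_snd (f := atTop (α := ℕ))))
      rw [sub_self, prod_atTop_atTop_eq] at h4
      simpa using h4.norm.pow 2
    refine h3.congr fun k => ?_
    have h5 := ((hG (u k.1)).sub (hG (u k.2))).sum_norm_sq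
    rw [hsub k] at h5
    have h6 := congrArg (starRingEnd ℂ) h5
    rw [Complex.conj_ofReal, inner_conj_symm] at h6
    exact h6

/-- The domain of the free Laplacian is dense in the Sobolev space. -/
theorem exists_formTendsto {f : L2On b.alcove} (hf : f ∈ sobolevW12 b.alcove) :
    ∃ u : ℕ → (freeLaplacian b).domain, FormTendsto (freeLaplacian b) u f := by
  let η := stdOrthonormalBasis ℝ V
  have hG := hP.freeLaplacian_greenIdentity_weakDeriv (b := b) η
  let E := PiLp 2 fun _ : Option (Fin (Module.finrank ℝ V)) => L2On b.alcove
  -- The map `u ↦ (u, ∇u)`, with the function in the slot `none`: the inner product of `E` induces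
  -- that of `W^{1,2}`.
  let J : L2On b.alcove → E := fun u =>
    WithLp.toLp 2 fun o => o.elim u fun j => weakDeriv b.alcove (η j) u
  have hW {u : L2On b.alcove} (hu : u ∈ sobolevW12 b.alcove) (y : V) :=
    hasWeakDeriv_weakDeriv hu y
  have hdW (x : (freeLaplacian b).domain) : (x : L2On b.alcove) ∈ sobolevW12 b.alcove :=
    mem_sobolevW12_of_orthonormalBasis η (hG x).hasWeakDeriv
  let JL : (freeLaplacian b).domain →ₗ[ℂ] E :=
    { toFun := fun x => J x
      map_add' := fun x y => by
        ext1 o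
        rcases o with _ | j
        · rfl
        · exact ((hW (hdW x) (η j)).add (hW (hdW y) (η j))).weakDeriv_eq b.isOpen_alcove
      map_smul' := fun c x => by
        ext1 o
        rcases o with _ | j
        · rfl
        · exact ((hW (hdW x) (η j)).smul c).weakDeriv_eq b.isOpen_alcove }
  let S : Submodule ℂ E := (LinearMap.range JL).topologicalClosure
  have hSc : IsClosed (S : Set E) := Submodule.isClosed_topologicalClosure _
  have : CompleteSpace S := hSc.completeSpace_coe
  have hpr (o : Option (Fin (Module.finrank ℝ V))) : Continuous fun e : E => e o :=
    PiLp.continuous_apply 2 _ o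
  have hSW : ∀ e ∈ S, ∀ j, HasWeakDeriv b.alcove (η j) (e none) (e (some j)) := by
    intro e he j
    have hcl : IsClosed {e : E | HasWeakDeriv b.alcove (η j) (e none) (e (some j))} :=
      (isClosed_hasWeakDeriv b.alcove (η j)).preimage ((hpr none).prodMk (hpr (some j)))
    refine closure_minimal ?_ hcl he
    rintro _ ⟨x, rfl⟩
    exact hW (hdW x) (η j)
  have hmem : J f ∈ S := by
    -- The part of `J f` orthogonal to the closed image of the domain. It still has the form of a
    -- function with its weak gradient.
    set e : E := J f - S.starProjection (J f) with he
    have heW (j) : HasWeakDeriv b.alcove (η j) (e none) (e (some j)) :=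
      (hW hf (η j)).sub (hSW _ (S.starProjection_apply_mem _) j)
    have hort : ∀ s ∈ S, ⟪s, e⟫_ℂ = 0 := by
      have := S.sub_starProjection_mem_orthogonal (J f)
      rwa [Submodule.mem_orthogonal] at this
    have he0 : e none = 0 := by
      refine hP.eq_zero_of_forall_inner_add_negLaplacian fun x₀ => ?_
      obtain ⟨x, hx, hTx⟩ : ∃ x : (freeLaplacian b).domain, (x : L2On b.alcove) = x₀ ∧
          freeLaplacian b x = negLaplacian P.affineWeylGroup b.alcove x₀ := by
        have hle : negLaplacian P.affineWeylGroup b.alcove ≤ freeLaplacian b :=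
          LinearPMap.le_closure _
        exact ⟨⟨x₀, hle.1 x₀.2⟩, rfl, (hle.2 rfl).symm⟩
      have h1 := hort (JL x) (Submodule.le_topologicalClosure _ ⟨x, rfl⟩)
      rw [PiLp.inner_apply, Fintype.sum_option] at h1
      -- Green's identity turns orthogonality to `J x` in `E` into `L²` orthogonality of `e none` to
      -- `x + H₀ x`.
      have h2 := (hG x).sum_inner (e none) (fun j => e (some j)) heW
      change ⟪(x : L2On b.alcove), e none⟫_ℂ
        + ∑ j, ⟪weakDeriv b.alcove (η j) (x : L2On b.alcove), e (some j)⟫_ℂ = 0 at h1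
      rw [h2, ← inner_add_left] at h1
      rw [← hx, ← hTx, ← inner_conj_symm, h1, map_zero]
    have hez : e = 0 := by
      ext1 o
      rcases o with _ | j
      · exact he0
      · have h1 := heW j
        rw [he0] at h1
        exact h1.unique b.isOpen_alcove (.zero (η j))
    rw [sub_eq_zero.1 (he.symm.trans hez)]
    exact S.starProjection_apply_mem _
  obtain ⟨s, hs, hlim⟩ := mem_closure_iff_seq_limit.1 hmem
  choose u hu using hs
  have hlim' (o) : Tendsto (fun n => (J (u n)) o) atTop (𝓝 ((J f) o)) := by
    refine (((hpr o).tendsto _).comp hlim).congr fun n => ?_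
    rw [Function.comp_apply, ← hu n]
    rfl
  exact ⟨u, (hP.formTendsto_iff η).2 ⟨hf, hlim' none, fun j => hlim' (some j)⟩⟩

theorem formDomain_freeLaplacian : formDomain (freeLaplacian b) = sobolevW12 b.alcove := by
  ext f
  constructor
  · rintro ⟨u, hu⟩
    exact ((hP.formTendsto_iff (stdOrthonormalBasis ℝ V)).1 hu).1
  · exact hP.exists_formTendsto

theorem hasFormValue_freeLaplacian (η : OrthonormalBasis κ ℝ V) {f g : L2On b.alcove}
    (hf : f ∈ sobolevW12 b.alcove) (hg : g ∈ sobolevW12 b.alcove) :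
    HasFormValue (freeLaplacian b) f g (gradientForm b.alcove η f g) := by
  rw [← hP.formDomain_freeLaplacian] at hf hg
  refine ⟨hf, hg, fun u v hu hv => ?_⟩
  obtain ⟨-, -, hu⟩ := (hP.formTendsto_iff η).1 hu
  obtain ⟨-, -, hv⟩ := (hP.formTendsto_iff η).1 hv
  have h1 : gradientForm b.alcove η f g
      = ∑ j, ⟪weakDeriv b.alcove (η j) g, weakDeriv b.alcove (η j) f⟫_ℂ :=
    Finset.sum_congr rfl fun j _ => (L2On.inner_eq_integral _ _).symm
  rw [h1]
  refine (tendsto_finsetSum _ fun j _ => (hv j).inner (hu j)).congr fun n => ?_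
  have hG := hP.freeLaplacian_greenIdentity_weakDeriv (b := b) η
  have h2 := (hG (u n)).sum_inner _ _ (hG (v n)).hasWeakDeriv
  dsimp only at h2
  rw [← inner_conj_symm, ← h2, map_sum]
  exact Finset.sum_congr rfl fun j _ => (inner_conj_symm _ _).symm

end RootPairing.IsEuclidean

end FreeLaplacian

end

theorem proposition4p2 {V : Type*} [NormedAddCommGroup V] [InnerProductSpace ℝ V]
    [FiniteDimensional ℝ V] [MeasurableSpace V] [BorelSpace V]
    {ι : Type*} [Finite ι] (P : RootPairing ι ℝ V V) (hP : P.IsEuclidean)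
    [P.IsRootSystem] [P.IsCrystallographic] [P.IsReduced] [P.IsIrreducible] (b : P.Base) :
    IsSelfAdjoint (freeLaplacian b) ∧
    formDomain (freeLaplacian b) = sobolevW12 b.alcove ∧
    ∀ {κ : Type*} [Fintype κ] (η : OrthonormalBasis κ ℝ V),
      ∀ f ∈ sobolevW12 b.alcove, ∀ g ∈ sobolevW12 b.alcove,
        HasFormValue (freeLaplacian b) f g
          (sobolevInner b.alcove η f g - ∫ v in b.alcove, f v * (starRingEnd ℂ) (g v)) := by
  refine ⟨hP.isSelfAdjoint_freeLaplacian, hP.formDomain_freeLaplacian, fun η f hf g hg => ?_⟩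
  rw [sobolevInner, add_sub_cancel_left]
  exact hP.hasFormValue_freeLaplacian η hf hg
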